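/- **Proposition 3.1.** Let $\Omega\subset\mathbb R^3$ be a bounded domain (nonempty, open, connected) with sufficiently smooth ($C^2$) boundary and outward unit normal $\mathbf n$, and let $T>0$. Let $\gamma\in\mathbb R$, $\psi_e\in C^2((0,\infty))$, $H,Q,b,\nu\in C^1(\mathbb R)$, $\kappa\in C((0,\infty)\times\mathbb R)$, and let $F_c$ be a real function of $(\rho,c)$. Put $$\psi_0(\rho,c)=\psi_e(\rho)+H(c)\log\rho+Q(c),\qquad p(\rho,c)=\rho^2\,\frac{\partial\psi_0}{\partial\rho}(\rho,c).$$ A *smooth solution* of G-NSCH is a quadruple $(\rho,\mathbf v,c,\mu)$ of functions of class $C^2$ on $[0,T]\times\overline\Omega$ (i.e. $C^2$ in a neighbourhood of each of its points), with $\rho>0$ there, such that in $(0,T)\times\Omega$ $$\partial_t\rho+\operatorname{div}(\rho\mathbf v)=0,$$ $$\partial_t(\rho c)+\operatorname{div}(\rho c\mathbf v)=\operatorname{div}(b(c)\nabla\mu)+F_c(\rho,c),$$ $$\rho\mu=-\gamma\Delta c+\rho\,\frac{\partial\psi_0}{\partial c},$$ $$\partial_t(\rho\mathbf v)+\operatorname{div}(\rho\mathbf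 v\otimes\mathbf v)=-\Big[\nabla p+\gamma\operatorname{div}\big(\nabla c\otimes\nabla c-\tfrac12|\nabla c|^2\mathbb I\big)\Big]+\operatorname{div}\big(\nu(c)(\nabla\mathbf v+\nabla\mathbf v^T)\big)-\tfrac23\nabla\big(\nu(c)\operatorname{div}\mathbf v\big)-\kappa(\rho,c)\mathbf v,$$ and on $(0,T)\times\partial\Omega$ $$\mathbf v=0,\qquad \frac{\partial c}{\partial\mathbf n}=0,\qquad b(c)\frac{\partial\mu}{\partial\mathbf n}=0.$$ Define $$E(t)=\int_\Omega\rho\frac{|\mathbf v|^2}{2}+\rho\psi_0+\frac\gamma2|\nabla c|^2\,dx,$$ $$D(t)=\int_\Omega\frac{\nu(c)}2\Big|\nabla\mathbf v+\nabla\mathbf v^T-\tfrac23\operatorname{div}(\mathbf v)\mathbb I\Big|^2+b(c)|\nabla\mu|^2+\kappa(\rho,c)|\mathbf v|^2\,dx .$$ 1. For every smooth solution and every $t\in(0,T)$, the integrands of $E(t)$ and $D(t)$ and the function $\mu F_c$ are integrable on $\Omega$, $E$ is differentiable at $t$, and $$\frac{d}{dt}E(t)+D(t)=\int_\Omega\mu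 F_c\,dx .$$ 2. Assume moreover that $\gamma>0$; that $\psi_e(\rho)=\frac{\rho^{a-1}}{a-1}$ for $\rho>0$ with some $a>2$; that $H$ and $H'$ are bounded; that either $Q(c)=\frac14c^2(1-c)^2$ for all $c$, or $Q$ and $Q'$ are bounded (truncated potential); that $b$ and $\nu$ are bounded from below by positive constants; that $\kappa\ge0$; and that $|F_c(\rho,c)|+|F_c(\rho,c)/\rho|$ is bounded over $\rho>0$, $c\in\mathbb R$. Then there are positive constants $C_1,C_2$, depending only on $\Omega$, $T$ and the data $\gamma,\psi_e,H,Q,b,\nu,\kappa,F_c$ (and not on the solution), such that for every smooth solution and every $t\in[0,T]$ the function $D$ is integrable on $(0,t)$ and $$E(t)+\int_0^tD(s)\,ds\le C_1+C_2\,E(0).$$ -/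

import Mathlib

open MeasureTheory Set
open scoped Gradient Laplacian

noncomputable section

namespace GNSCH

/-- Three-dimensional Euclidean space. -/
abbrev E3 : Type := EuclideanSpace ℝ (Fin 3)

/-- The partial derivative `∂f/∂xᵢ` of a scalar function. -/
def pd (i : Fin 3) (f : E3 → ℝ) (x : E3) : ℝ :=
  fderiv ℝ f x (EuclideanSpace.single i 1)

/-- The divergence of a vector field. -/
def dvg (X : E3 → E3) (x : E3) : ℝ := ∑ i, pd i (fun y => X y i) x

/-- A bounded domain (nonempty, connected, open subset) of `ℝ³` with regular boundary,
given by a defining function: `Ω = {φ < 0}` with `φ` of class `C²` on `ℝ³` and `∇φ ≠ 0` on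
`{φ = 0}`, which is then the boundary of `Ω`.  Every bounded domain whose boundary is a closed
hypersurface of class `C²` (in particular every smooth bounded domain) has such a defining
function, and nothing below depends on which one is taken. -/
structure RegularDomain where
  /-- the domain -/
  Ω : Set E3
  /-- a defining function -/
  φ : E3 → ℝ
  connected : IsConnected Ω
  bounded : Bornology.IsBounded Ω
  contDiff_φ : ContDiff ℝ 2 φ
  eq_sublevel : Ω = {x | φ x < 0}
  gradient_ne_zero : ∀ x, φ x = 0 → ∇ φ x ≠ 0

/-- The outward unit normal on the boundary. -/
def RegularDomain.normal (U : RegularDomain) (x : E3) : E3 :=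
  ‖∇ U.φ x‖⁻¹ • ∇ U.φ x

/-- The normal derivative `∂f/∂n` at a boundary point. -/
def RegularDomain.normalDeriv (U : RegularDomain) (f : E3 → ℝ) (x : E3) : ℝ :=
  inner ℝ (∇ f x) (U.normal x)

/-- The constitutive data of the system. -/
structure Model where
  /-- surface tension coefficient -/
  γ : ℝ
  /-- the part of the free energy that depends on the density only -/
  ψe : ℝ → ℝ
  /-- coefficient of `log ρ` in the mixing energy -/
  H : ℝ → ℝ
  /-- double-well potential -/
  Q : ℝ → ℝ
  /-- mobility, a function of `c` -/
  b : ℝ → ℝ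
  /-- viscosity, a function of `c` -/
  ν : ℝ → ℝ
  /-- friction coefficient, a function of `ρ` and `c` -/
  κ : ℝ → ℝ → ℝ
  /-- source term, a function of `ρ` and `c` -/
  F : ℝ → ℝ → ℝ

namespace Model

/-- The homogeneous free energy `ψ₀(ρ, c) = ψₑ(ρ) + H(c) log ρ + Q(c)`. -/
def ψ₀ (M : Model) (r s : ℝ) : ℝ := M.ψe r + M.H s * Real.log r + M.Q s

/-- `∂ψ₀/∂c`. -/
def dcψ₀ (M : Model) (r s : ℝ) : ℝ := deriv (fun s' => M.ψ₀ r s') s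

/-- The pressure `p(ρ, c) = ρ² ∂ψ₀/∂ρ`. -/
def p (M : Model) (r s : ℝ) : ℝ := r ^ 2 * deriv (fun r' => M.ψ₀ r' s) r

/-- Regularity of the data under which the system makes classical sense for `ρ > 0`. -/
structure Regular (M : Model) : Prop where
  ψe : ContDiffOn ℝ 2 M.ψe (Ioi 0)
  H : ContDiff ℝ 1 M.H
  Q : ContDiff ℝ 1 M.Q
  b : ContDiff ℝ 1 M.b
  ν : ContDiff ℝ 1 M.ν
  κ : ContinuousOn (fun z : ℝ × ℝ => M.κ z.1 z.2) (Ioi 0 ×ˢ univ)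

/-- The structural assumptions for the a priori estimate, with pressure exponent `a`.  The
potential is either the quartic double well or a truncation of it, that is, a function which is
bounded together with its derivative. -/
structure Admissible (M : Model) (a : ℝ) : Prop where
  γ_pos : 0 < M.γ
  two_lt : 2 < a
  ψe_eq : ∀ r, 0 < r → M.ψe r = r ^ (a - 1) / (a - 1)
  H_bdd : ∃ K, ∀ s, |M.H s| ≤ K ∧ |deriv M.H s| ≤ K
  Q_spec : (∀ s, M.Q s = s ^ 2 * (1 - s) ^ 2 / 4) ∨
    ∃ K, ∀ s, |M.Q s| ≤ K ∧ |deriv M.Q s| ≤ K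
  b_lower : ∃ b₀, 0 < b₀ ∧ ∀ s, b₀ ≤ M.b s
  ν_lower : ∃ ν₀, 0 < ν₀ ∧ ∀ s, ν₀ ≤ M.ν s
  κ_nonneg : ∀ r s, 0 < r → 0 ≤ M.κ r s
  F_bdd : ∃ K, ∀ r s, 0 < r → |M.F r s| + |M.F r s / r| ≤ K

end Model

/-- A real function on space-time, or a vector field, is of class `C²` on `[0,T] × closure Ω`,
up to the boundary: it is `C²` in a neighbourhood of every point of that set. -/
def C2UpToBoundary {F : Type*} [NormedAddCommGroup F] [NormedSpace ℝ F]
    (U : RegularDomain) (T : ℝ) (f : ℝ → E3 → F) : Prop :=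
  ∀ t ∈ Icc 0 T, ∀ x ∈ closure U.Ω, ContDiffAt ℝ 2 (fun z : ℝ × E3 => f z.1 z.2) (t, x)

/-- `(ρ, v, c, μ)` is a classical solution, without vacuum, of the generalized compressible
Navier-Stokes-Cahn-Hilliard system in `(0,T) × Ω` with its boundary conditions. -/
structure IsSolution (M : Model) (U : RegularDomain) (T : ℝ)
    (ρ : ℝ → E3 → ℝ) (v : ℝ → E3 → E3) (c μ : ℝ → E3 → ℝ) : Prop where
  reg_ρ : C2UpToBoundary U T ρ
  reg_v : C2UpToBoundary U T v
  reg_c : C2UpToBoundary U T c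
  reg_μ : C2UpToBoundary U T μ
  ρ_pos : ∀ t ∈ Icc 0 T, ∀ x ∈ closure U.Ω, 0 < ρ t x
  /-- `∂ₜρ + div(ρ v) = 0` -/
  mass : ∀ t ∈ Ioo 0 T, ∀ x ∈ U.Ω,
    deriv (fun s => ρ s x) t + dvg (fun y => ρ t y • v t y) x = 0
  /-- `∂ₜ(ρ c) + div(ρ c v) = div(b(c) ∇μ) + F_c` -/
  fraction : ∀ t ∈ Ioo 0 T, ∀ x ∈ U.Ω,
    deriv (fun s => ρ s x * c s x) t + dvg (fun y => (ρ t y * c t y) • v t y) x =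
      dvg (fun y => M.b (c t y) • ∇ (μ t) y) x + M.F (ρ t x) (c t x)
  /-- `ρ μ = -γ Δc + ρ ∂ψ₀/∂c` -/
  potential : ∀ t ∈ Ioo 0 T, ∀ x ∈ U.Ω,
    ρ t x * μ t x = -M.γ * Δ (c t) x + ρ t x * M.dcψ₀ (ρ t x) (c t x)
  /-- `∂ₜ(ρ v) + div(ρ v ⊗ v) = -[∇p + γ div(∇c ⊗ ∇c - ½|∇c|² I)]
  + div(ν(c)(∇v + ∇vᵀ)) - ⅔ ∇(ν(c) div v) - κ(ρ,c) v`, by components -/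
  momentum : ∀ t ∈ Ioo 0 T, ∀ x ∈ U.Ω, ∀ i : Fin 3,
    deriv (fun s => ρ s x * v s x i) t + ∑ j, pd j (fun y => ρ t y * v t y i * v t y j) x =
      -(pd i (fun y => M.p (ρ t y) (c t y)) x
          + M.γ * ∑ j, pd j (fun y => pd i (c t) y * pd j (c t) y
              - (if i = j then ‖∇ (c t) y‖ ^ 2 / 2 else 0)) x)
        + ∑ j, pd j (fun y => M.ν (c t y) *
            (pd j (fun z => v t z i) y + pd i (fun z => v t z j) y)) x
        - 2 / 3 * pd i (fun y => M.ν (c t y) * dvg (v t) y) x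
        - M.κ (ρ t x) (c t x) * v t x i
  bc_v : ∀ t ∈ Ioo 0 T, ∀ x ∈ frontier U.Ω, v t x = 0
  bc_c : ∀ t ∈ Ioo 0 T, ∀ x ∈ frontier U.Ω, U.normalDeriv (c t) x = 0
  bc_μ : ∀ t ∈ Ioo 0 T, ∀ x ∈ frontier U.Ω, M.b (c t x) * U.normalDeriv (μ t) x = 0

/-- The squared Frobenius norm `|∇w + ∇wᵀ - ⅔ (div w) I|²`. -/
def deviatoricSq (w : E3 → E3) (x : E3) : ℝ :=
  ∑ i, ∑ j, (pd j (fun y => w y i) x + pd i (fun y => w y j) x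
    - (if i = j then 2 / 3 * dvg w x else 0)) ^ 2

/-- The energy density `ρ|v|²/2 + ρψ₀ + (γ/2)|∇c|²` (of the state at a fixed time). -/
def energyDensity (M : Model) (ρ : E3 → ℝ) (v : E3 → E3) (c : E3 → ℝ) (x : E3) : ℝ :=
  ρ x * (‖v x‖ ^ 2 / 2) + ρ x * M.ψ₀ (ρ x) (c x) + M.γ / 2 * ‖∇ c x‖ ^ 2

/-- The dissipation density `(ν(c)/2)|∇v + ∇vᵀ - ⅔ (div v) I|² + b(c)|∇μ|² + κ(ρ,c)|v|²`. -/
def dissipationDensity (M : Model) (ρ : E3 → ℝ) (v : E3 → E3) (c μ : E3 → ℝ) (x : E3) : ℝ :=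
  M.ν (c x) / 2 * deviatoricSq v x + M.b (c x) * ‖∇ μ x‖ ^ 2
    + M.κ (ρ x) (c x) * ‖v x‖ ^ 2

/-- The energy `E(t)`. -/
def energy (M : Model) (U : RegularDomain) (ρ : ℝ → E3 → ℝ) (v : ℝ → E3 → E3)
    (c : ℝ → E3 → ℝ) (t : ℝ) : ℝ :=
  ∫ x in U.Ω, energyDensity M (ρ t) (v t) (c t) x

/-- The dissipation `D(t)`. -/
def dissipation (M : Model) (U : RegularDomain) (ρ : ℝ → E3 → ℝ) (v : ℝ → E3 → E3)
    (c μ : ℝ → E3 → ℝ) (t : ℝ) : ℝ :=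
  ∫ x in U.Ω, dissipationDensity M (ρ t) (v t) (c t) (μ t) x

end GNSCH

end

namespace GNSCH

/-! ### Poincaré–Wirtinger inequality on a bounded connected `C²` domain -/

section Poincare

open Metric Filter Topology
open scoped NNReal ENNReal

/-! The energy law is local before it is global. Testing momentum with `v`, mass with `ρ ∂ψ₀/∂ρ`,
the mass-fraction equation with `μ` and the potential equation with minus the material derivative of
`c` gives, at each point of `Ω`, that the time derivative of the energy density plus the dissipation
density minus `μ F` is the divergence of an explicit flux (`energy_identity`). The boundary
conditions make this flux tangential, so its divergence integrates to zero
(`RegularDomain.integral_dvg_eq_zero`); differentiation under the integral finishes part 1.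

For part 2 the power `∫ μ F` must be absorbed. The equations bound `∇μ` through the dissipation, but
not `μ` itself, so `μ` is split as `(μ - m) + m` with `m` from the Poincaré inequality. Since `|F| ≤
K ρ`, the fluctuation costs a small multiple of the dissipation plus a multiple of `∫ ρ²`. For the
constant part only `m ∫ ρ` matters, and integrating the potential equation gives `∫ ρ μ = ∫ ρ
∂ψ₀/∂c`, because `Δc` has zero integral (`integral_density_mul_potential`). As `a > 2`, the free
energy dominates both `ρ²` and `ρ |∂ψ₀/∂c|` (`Model.Admissible.exists_sq_add_le`). Hence `∫ μ F` is
at most half the dissipation plus an affine function of the energy (`integral_mul_source_le`), and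
Gronwall concludes.

The two analytic tools are proved directly from the defining function: the Poincaré inequality by
propagating `L²` control through translations of balls, the divergence theorem by cutting off near
the boundary. -/

theorem sq_integral_unit_le {g : ℝ → ℝ} (hg : ContinuousOn g (Icc 0 1)) :
    (∫ s in (0 : ℝ)..1, g s) ^ 2 ≤ ∫ s in (0 : ℝ)..1, g s ^ 2 := by
  have hg' : ContinuousOn g (uIcc 0 1) := by rwa [uIcc_of_le zero_le_one]
  set m := ∫ s in (0 : ℝ)..1, g s with hm
  have h1 : 0 ≤ ∫ s in (0 : ℝ)..1, (g s - m) ^ 2 :=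
    intervalIntegral.integral_nonneg zero_le_one fun _ _ => sq_nonneg _
  have h2 : ∫ s in (0 : ℝ)..1, (g s - m) ^ 2 =
      (∫ s in (0 : ℝ)..1, g s ^ 2) - 2 * m * m + m ^ 2 := by
    have e : ∀ s, (g s - m) ^ 2 = g s ^ 2 - 2 * m * g s + m ^ 2 := fun s => by ring
    simp only [e]
    rw [intervalIntegral.integral_add, intervalIntegral.integral_sub,
      intervalIntegral.integral_const_mul, ← hm]
    · simp
    · exact (hg'.pow 2).intervalIntegrable
    · exact (continuousOn_const.mul hg').intervalIntegrable
    · exact ((hg'.pow 2).sub (continuousOn_const.mul hg')).intervalIntegrable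
    · exact intervalIntegrable_const
  nlinarith

/-- The fundamental theorem of calculus along the segment, followed by Cauchy–Schwarz in the
parameter. Extended nonnegative integrals are used because a `C¹` function on the open set may have
infinite Dirichlet energy. -/
theorem enorm_sq_sub_le_lintegral_segment {Ω : Set E3} (hΩ : IsOpen Ω) {u : E3 → ℝ}
    (hu : ContDiffOn ℝ 1 u Ω) {x h : E3} (hseg : ∀ s ∈ Icc (0 : ℝ) 1, x + s • h ∈ Ω) :
    ‖u (x + h) - u x‖ₑ ^ 2 ≤
      ‖h‖ₑ ^ 2 * ∫⁻ s in Icc (0 : ℝ) 1, ‖fderiv ℝ u (x + s • h)‖ₑ ^ 2 := by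
  have hline : ∀ s : ℝ, HasDerivAt (fun s : ℝ => x + s • h) h s := fun s => by
    simpa using ((hasDerivAt_id s).smul_const h).const_add x
  have hd : ∀ s ∈ Icc (0 : ℝ) 1,
      HasDerivAt (fun s : ℝ => u (x + s • h)) (fderiv ℝ u (x + s • h) h) s := fun s hs => by
    have hda : DifferentiableAt ℝ u (x + s • h) :=
      (hu.contDiffAt (hΩ.mem_nhds (hseg s hs))).differentiableAt one_ne_zero
    exact hda.hasFDerivAt.comp_hasDerivAt s (hline s)
  have hcf : ContinuousOn (fun s : ℝ => fderiv ℝ u (x + s • h)) (Icc 0 1) :=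
    (hu.continuousOn_fderiv_of_isOpen hΩ le_rfl).comp (by fun_prop) hseg
  have hc : ContinuousOn (fun s : ℝ => fderiv ℝ u (x + s • h) h) (Icc 0 1) :=
    hcf.clm_apply continuousOn_const
  have hI : u (x + h) - u x = ∫ s in (0 : ℝ)..1, fderiv ℝ u (x + s • h) h := by
    rw [intervalIntegral.integral_eq_sub_of_hasDerivAt (f := fun s : ℝ => u (x + s • h))]
    · simp
    · rwa [uIcc_of_le zero_le_one]
    · exact ContinuousOn.intervalIntegrable (by rwa [uIcc_of_le zero_le_one])
  have hsq := sq_integral_unit_le hc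
  rw [← hI, intervalIntegral.integral_of_le zero_le_one, ← integral_Icc_eq_integral_Ioc] at hsq
  calc ‖u (x + h) - u x‖ₑ ^ 2 = ENNReal.ofReal ((u (x + h) - u x) ^ 2) := by
        rw [Real.enorm_eq_ofReal_abs, ← ENNReal.ofReal_pow (abs_nonneg _), sq_abs]
    _ ≤ ENNReal.ofReal (∫ s in Icc (0 : ℝ) 1, (fderiv ℝ u (x + s • h) h) ^ 2) :=
        ENNReal.ofReal_le_ofReal hsq
    _ = ∫⁻ s in Icc (0 : ℝ) 1, ENNReal.ofReal ((fderiv ℝ u (x + s • h) h) ^ 2) :=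
        ofReal_integral_eq_lintegral_ofReal ((hc.pow 2).integrableOn_Icc)
          (ae_of_all _ fun _ => sq_nonneg _)
    _ ≤ ∫⁻ s in Icc (0 : ℝ) 1, ‖h‖ₑ ^ 2 * ‖fderiv ℝ u (x + s • h)‖ₑ ^ 2 := by
        refine lintegral_mono fun s => ?_
        simp only
        rw [← sq_abs, ENNReal.ofReal_pow (abs_nonneg _), ← Real.enorm_eq_ofReal_abs, ← mul_pow,
          mul_comm]
        gcongr
        exact ContinuousLinearMap.le_opENorm _ _
    _ = _ := lintegral_const_mul' _ _ (by finiteness)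

theorem lintegral_comp_add_le_of_mapsTo {Ω A : Set E3} (hΩ : MeasurableSet Ω)
    (hA : MeasurableSet A) (f : E3 → ℝ≥0∞) {h : E3} (hAΩ : ∀ x ∈ A, x + h ∈ Ω) :
    ∫⁻ x in A, f (x + h) ≤ ∫⁻ x in Ω, f x := by
  rw [← lintegral_indicator hΩ, ← lintegral_indicator hA,
    ← lintegral_add_right_eq_self (Ω.indicator f) h]
  refine lintegral_mono fun x => ?_
  by_cases hx : x ∈ A
  · simp [hx, hAΩ x hx]
  · simp [hx]

/-- By Tonelli the segment bound may be integrated over `A` for each fixed `s`; the translate of `A`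
by `s • h` lies in `Ω`, so each slice costs at most the full Dirichlet energy. -/
theorem lintegral_sq_sub_translate_le {Ω A : Set E3} (hΩ : IsOpen Ω) (hA : MeasurableSet A)
    {u : E3 → ℝ} (hu : ContDiffOn ℝ 1 u Ω) {h : E3}
    (hseg : ∀ x ∈ A, ∀ s ∈ Icc (0 : ℝ) 1, x + s • h ∈ Ω) :
    ∫⁻ x in A, ‖u (x + h) - u x‖ₑ ^ 2 ≤ ‖h‖ₑ ^ 2 * ∫⁻ x in Ω, ‖fderiv ℝ u x‖ₑ ^ 2 := by
  have hmeas : Measurable (Function.uncurry fun (x : E3) (s : ℝ) =>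
      ‖fderiv ℝ u (x + s • h)‖ₑ ^ 2) := by
    have : Measurable fun p : E3 × ℝ => p.1 + p.2 • h := by fun_prop
    exact (((measurable_fderiv ℝ u).comp this).enorm).pow_const 2
  calc ∫⁻ x in A, ‖u (x + h) - u x‖ₑ ^ 2
      ≤ ∫⁻ x in A, ‖h‖ₑ ^ 2 * ∫⁻ s in Icc (0 : ℝ) 1, ‖fderiv ℝ u (x + s • h)‖ₑ ^ 2 :=
        setLIntegral_mono' hA fun x hx => enorm_sq_sub_le_lintegral_segment hΩ hu (hseg x hx)
    _ = ‖h‖ₑ ^ 2 * ∫⁻ s in Icc (0 : ℝ) 1, ∫⁻ x in A, ‖fderiv ℝ u (x + s • h)‖ₑ ^ 2 := by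
        rw [lintegral_const_mul' _ _ (by finiteness), lintegral_lintegral_swap hmeas.aemeasurable]
    _ ≤ ‖h‖ₑ ^ 2 * ∫⁻ s in Icc (0 : ℝ) 1, ∫⁻ x in Ω, ‖fderiv ℝ u x‖ₑ ^ 2 := by
        refine mul_le_mul_right (setLIntegral_mono' measurableSet_Icc fun s hs => ?_) _
        exact lintegral_comp_add_le_of_mapsTo hΩ.measurableSet hA
          (fun x => ‖fderiv ℝ u x‖ₑ ^ 2) fun x hx => hseg x hx s hs
    _ = _ := by simp

/-- The `L²` norm on `A` of a `C¹` function on `Ω` is controlled by its Dirichlet energy on `Ω`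
together with its `L²` norm on `B`. -/
def GradControlled (Ω B A : Set E3) : Prop :=
  ∃ C : ℝ≥0, ∀ u : E3 → ℝ, ContDiffOn ℝ 1 u Ω →
    ∫⁻ x in A, ‖u x‖ₑ ^ 2 ≤ C * ((∫⁻ x in Ω, ‖fderiv ℝ u x‖ₑ ^ 2) + ∫⁻ x in B, ‖u x‖ₑ ^ 2)

theorem GradControlled.refl (Ω B : Set E3) : GradControlled Ω B B :=
  ⟨1, fun u _ => by simp⟩

theorem GradControlled.mono {Ω B A A' : Set E3} (h : GradControlled Ω B A) (hA : A' ⊆ A) :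
    GradControlled Ω B A' := by
  obtain ⟨C, hC⟩ := h
  exact ⟨C, fun u hu => (lintegral_mono_set hA).trans (hC u hu)⟩

theorem GradControlled.union {Ω B A A' : Set E3} (h : GradControlled Ω B A)
    (h' : GradControlled Ω B A') : GradControlled Ω B (A ∪ A') := by
  obtain ⟨C, hC⟩ := h
  obtain ⟨C', hC'⟩ := h'
  refine ⟨C + C', fun u hu => (lintegral_union_le _ _ _).trans ?_⟩
  rw [ENNReal.coe_add, add_mul]
  exact add_le_add (hC u hu) (hC' u hu)

theorem enorm_sq_le_two_mul (a b : ℝ) : ‖b‖ₑ ^ 2 ≤ 2 * ‖a - b‖ₑ ^ 2 + 2 * ‖a‖ₑ ^ 2 := by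
  have e : ∀ y : ℝ, ‖y‖ₑ ^ 2 = ENNReal.ofReal (y ^ 2) := fun y => by
    rw [Real.enorm_eq_ofReal_abs, ← ENNReal.ofReal_pow (abs_nonneg _), sq_abs]
  have h2 : (2 : ℝ≥0∞) = ENNReal.ofReal 2 := by simp
  rw [e, e, e, h2, ← ENNReal.ofReal_mul zero_le_two, ← ENNReal.ofReal_mul zero_le_two,
    ← ENNReal.ofReal_add (by positivity) (by positivity)]
  exact ENNReal.ofReal_le_ofReal (by nlinarith [sq_nonneg (2 * a - b)])

/-- Write `u x` as `u (x + k)` minus an increment: the first is controlled on `A`, the increment by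
the Dirichlet energy. Control thus passes from a set to any set that can be slid onto it inside `Ω`.
-/
theorem GradControlled.translate {Ω B A A' : Set E3} (hΩ : IsOpen Ω) (hA : MeasurableSet A)
    (hA' : MeasurableSet A') (h : GradControlled Ω B A) {k : E3} (hk : ∀ x ∈ A', x + k ∈ A)
    (hseg : ∀ x ∈ A', ∀ s ∈ Icc (0 : ℝ) 1, x + s • k ∈ Ω) : GradControlled Ω B A' := by
  obtain ⟨C, hC⟩ := h
  refine ⟨2 * ‖k‖₊ ^ 2 + 2 * C, fun u hu => ?_⟩
  set G := ∫⁻ x in Ω, ‖fderiv ℝ u x‖ₑ ^ 2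
  set N := ∫⁻ x in B, ‖u x‖ₑ ^ 2
  have hcont : ContinuousOn (fun x => u (x + k) - u x) A' :=
    (hu.continuousOn.comp (by fun_prop) fun x hx => by simpa using hseg x hx 1 (by simp)).sub
      (hu.continuousOn.mono fun x hx => by simpa using hseg x hx 0 (by simp))
  have hm : AEMeasurable (fun x => ‖u (x + k) - u x‖ₑ ^ 2) (volume.restrict A') :=
    ((hcont.aestronglyMeasurable hA').aemeasurable.enorm).pow_const 2
  calc ∫⁻ x in A', ‖u x‖ₑ ^ 2
      ≤ ∫⁻ x in A', (2 * ‖u (x + k) - u x‖ₑ ^ 2 + 2 * ‖u (x + k)‖ₑ ^ 2) :=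
        lintegral_mono fun x => enorm_sq_le_two_mul _ _
    _ = 2 * (∫⁻ x in A', ‖u (x + k) - u x‖ₑ ^ 2) + 2 * ∫⁻ x in A', ‖u (x + k)‖ₑ ^ 2 := by
        rw [lintegral_add_left' (hm.const_mul 2), lintegral_const_mul' _ _ (by simp),
          lintegral_const_mul' _ _ (by simp)]
    _ ≤ 2 * (‖k‖ₑ ^ 2 * G) + 2 * (C * (G + N)) := by
        gcongr
        · exact lintegral_sq_sub_translate_le hΩ hA' hu hseg
        · exact (lintegral_comp_add_le_of_mapsTo hA hA' (fun x => ‖u x‖ₑ ^ 2) hk).trans (hC u hu)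
    _ ≤ 2 * (‖k‖ₑ ^ 2 * (G + N)) + 2 * (C * (G + N)) := by
        gcongr; exact le_self_add
    _ = _ := by
        push_cast
        rw [← enorm_eq_nnnorm]
        ring

theorem measurable_indicator_of_contDiffOn {Ω : Set E3} (hΩ : IsOpen Ω) {u : E3 → ℝ}
    (hu : ContDiffOn ℝ 1 u Ω) : Measurable (Ω.indicator u) := by
  classical
  have : Measurable (Ω.piecewise u 0) :=
    hu.continuousOn.measurable_piecewise (g := 0) continuousOn_const hΩ.measurableSet
  rwa [piecewise_eq_indicator] at this

/-- Substitute `y = x + h`. Convexity keeps the segment from `x` to `y` in `B`, and only `h` of norm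
below `2 * R` occurs, so the translation estimate can be integrated over `h`. -/
theorem lintegral_lintegral_sq_sub_le {Ω B : Set E3} (hΩ : IsOpen Ω) (hB : MeasurableSet B)
    (hconv : Convex ℝ B) (hBΩ : B ⊆ Ω) {R : ℝ} (hR : B ⊆ ball 0 R) {u : E3 → ℝ}
    (hu : ContDiffOn ℝ 1 u Ω) :
    ∫⁻ x in B, ∫⁻ y in B, ‖u y - u x‖ₑ ^ 2 ≤
      (∫⁻ h in ball (0 : E3) (2 * R), ‖h‖ₑ ^ 2) * ∫⁻ x in Ω, ‖fderiv ℝ u x‖ₑ ^ 2 := by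
  classical
  -- `u` is arbitrary outside `Ω`; its extension by zero is globally measurable, as Tonelli
  -- requires.
  set w : E3 → ℝ := Ω.indicator u with hw
  have hwm : Measurable w := measurable_indicator_of_contDiffOn hΩ hu
  have hwu : ∀ x ∈ B, w x = u x := fun x hx => indicator_of_mem (hBΩ hx) u
  set G : E3 → E3 → ℝ≥0∞ := fun x h => B.indicator (fun y => ‖w y - w x‖ₑ ^ 2) (x + h) with hG
  have hGm : Measurable (Function.uncurry G) := by
    have hadd : Measurable fun p : E3 × E3 => p.1 + p.2 := by fun_prop
    have e : Function.uncurry G = ((fun p : E3 × E3 => p.1 + p.2) ⁻¹' B).indicator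
        fun p => ‖w (p.1 + p.2) - w p.1‖ₑ ^ 2 := by
      ext p
      simp [hG, Function.uncurry, indicator]
    rw [e]
    exact ((((hwm.comp hadd).sub (hwm.comp measurable_fst)).enorm).pow_const 2).indicator
      (hadd hB)
  calc ∫⁻ x in B, ∫⁻ y in B, ‖u y - u x‖ₑ ^ 2 = ∫⁻ x in B, ∫⁻ h, G x h := by
        refine setLIntegral_congr_fun hB fun x hx => ?_
        simp only [hG]
        rw [lintegral_add_left_eq_self (B.indicator fun y => ‖w y - w x‖ₑ ^ 2) x,
          lintegral_indicator hB]
        exact setLIntegral_congr_fun hB fun y hy => by simp only [hwu x hx, hwu y hy]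
    _ = ∫⁻ h, ∫⁻ x in B, G x h := lintegral_lintegral_swap hGm.aemeasurable
    _ ≤ ∫⁻ h, (ball (0 : E3) (2 * R)).indicator
          (fun h => ‖h‖ₑ ^ 2 * ∫⁻ x in Ω, ‖fderiv ℝ u x‖ₑ ^ 2) h := by
        refine lintegral_mono fun h => ?_
        have hAm : MeasurableSet (B ∩ (fun x => x + h) ⁻¹' B) :=
          hB.inter ((measurable_add_const h) hB)
        have e : ∫⁻ x in B, G x h =
            ∫⁻ x in B ∩ (fun x => x + h) ⁻¹' B, ‖u (x + h) - u x‖ₑ ^ 2 := by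
          rw [← lintegral_indicator hB, ← lintegral_indicator hAm]
          congr 1
          ext x
          by_cases hx : x ∈ B <;> by_cases hy : x + h ∈ B <;> simp [hG, hx, hy, hwu]
        rw [e]
        by_cases hh : h ∈ ball (0 : E3) (2 * R)
        · rw [indicator_of_mem hh]
          refine lintegral_sq_sub_translate_le hΩ hAm hu fun x hx s hs => hBΩ ?_
          have := hconv hx.1 hx.2 (sub_nonneg.2 hs.2) hs.1 (by ring)
          convert this using 1
          module
        · have : B ∩ (fun x => x + h) ⁻¹' B = ∅ := by
            ext x
            simp only [mem_inter_iff, mem_preimage, mem_empty_iff_false, iff_false, not_and]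
            intro hx hy
            apply hh
            have h1 := hR hx
            have h2 := hR hy
            rw [mem_ball_zero_iff] at *
            calc ‖h‖ = ‖x + h - x‖ := by simp
              _ ≤ ‖x + h‖ + ‖x‖ := norm_sub_le _ _
              _ < 2 * R := by linarith
          simp [this]
    _ = _ := by
        rw [lintegral_indicator measurableSet_ball, lintegral_mul_const]
        fun_prop

theorem ball_add_smul_mem {x y z : E3} {r ε : ℝ} (hxy : dist y x + ε ≤ r) (hz : z ∈ ball x ε)
    {s : ℝ} (hs : s ∈ Icc (0 : ℝ) 1) : z + s • (y - x) ∈ ball x r := by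
  have hz' : ‖z - x‖ < ε := by rwa [mem_ball, dist_eq_norm] at hz
  rw [dist_eq_norm] at hxy
  rw [mem_ball, dist_eq_norm]
  calc ‖z + s • (y - x) - x‖ = ‖(z - x) + s • (y - x)‖ := by congr 1; abel
    _ ≤ ‖z - x‖ + ‖s • (y - x)‖ := norm_add_le _ _
    _ ≤ ‖z - x‖ + ‖y - x‖ := by
        rw [norm_smul, Real.norm_of_nonneg hs.1]
        gcongr
        exact mul_le_of_le_one_left (norm_nonneg _) hs.2
    _ < r := by linarith

theorem GradControlled.of_mem_ball {Ω B : Set E3} (hΩ : IsOpen Ω) {x y : E3} {r ε : ℝ}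
    (hxr : ball x r ⊆ Ω) (hxy : dist y x + ε ≤ r) (h : GradControlled Ω B (ball y ε)) :
    GradControlled Ω B (ball x ε) :=
  h.translate hΩ measurableSet_ball measurableSet_ball (k := y - x)
    (fun z hz => by
      rw [mem_ball, dist_eq_norm] at hz ⊢
      rwa [show z + (y - x) - y = z - x by abel])
    fun _ hz _ hs => hxr (ball_add_smul_mem hxy hz hs)

/-- The centres of controlled balls form an open set that is relatively closed in `Ω`: near a limit
point there is a controlled centre, and a small ball can be slid onto it within a ball contained in
`Ω`. Connectedness does the rest. -/
theorem exists_gradControlled_ball {Ω : Set E3} (hΩ : IsOpen Ω) (hconn : IsConnected Ω)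
    {x₀ : E3} {r₀ : ℝ} (hr₀ : 0 < r₀) (hB : ball x₀ r₀ ⊆ Ω) {x : E3} (hx : x ∈ Ω) :
    ∃ r > 0, GradControlled Ω (ball x₀ r₀) (ball x r) := by
  set S : Set E3 := {x | ∃ r > 0, ball x r ⊆ Ω ∧ GradControlled Ω (ball x₀ r₀) (ball x r)} with hS
  have hSo : IsOpen S := by
    rw [Metric.isOpen_iff]
    rintro y ⟨r, hr, hyΩ, hc⟩
    refine ⟨r, hr, fun z hz => ⟨r - dist z y, by simpa using hz, ?_, hc.mono ?_⟩⟩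
    · exact (ball_subset_ball' (by linarith)).trans hyΩ
    · exact ball_subset_ball' (by linarith)
  have key : Ω ⊆ S := by
    refine hconn.isPreconnected.subset_of_closure_inter_subset hSo
      ⟨x₀, hB (mem_ball_self hr₀), r₀, hr₀, hB, .refl _ _⟩ ?_
    rintro z ⟨hzS, hzΩ⟩
    obtain ⟨r, hr, hzr⟩ := Metric.isOpen_iff.1 hΩ z hzΩ
    obtain ⟨y, ⟨ρ, hρ, -, hc⟩, hyz⟩ := Metric.mem_closure_iff.1 hzS r hr
    rw [dist_comm] at hyz
    -- This radius makes the translated ball fit in the controlled one and keeps the swept segments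
    -- inside `ball z r`.
    have hε : 0 < min ρ (r - dist y z) := lt_min hρ (by linarith)
    refine ⟨min ρ (r - dist y z), hε, (ball_subset_ball ?_).trans hzr, ?_⟩
    · exact (min_le_right _ _).trans (by linarith [dist_nonneg (x := y) (y := z)])
    · exact GradControlled.of_mem_ball hΩ hzr (r := r)
        (by linarith [min_le_right ρ (r - dist y z)]) (hc.mono (ball_subset_ball (min_le_left _ _)))
  obtain ⟨r, hr, -, hc⟩ := key hx
  exact ⟨r, hr, hc⟩

namespace RegularDomain

variable (U : RegularDomain)

theorem isOpen : IsOpen U.Ω := by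
  rw [U.eq_sublevel]
  exact isOpen_lt U.contDiff_φ.continuous continuous_const

theorem isCompact_closure : IsCompact (closure U.Ω) := U.bounded.isCompact_closure

theorem phi_eq_zero_of_mem_frontier {x : E3} (hx : x ∈ frontier U.Ω) : U.φ x = 0 := by
  rw [U.eq_sublevel] at hx
  exact frontier_lt_subset_eq U.contDiff_φ.continuous continuous_const hx

/-- Near a zero of `φ` there is a direction along which `φ` grows at a uniform rate. -/
theorem exists_direction {x : E3} (hx : U.φ x = 0) :
    ∃ e : E3, ∃ δ > 0, ∃ m > 0, ‖e‖ = 1 ∧ ∀ y ∈ ball x δ, ∀ s, 0 ≤ s → y + s • e ∈ ball x δ →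
      U.φ y + m * s ≤ U.φ (y + s • e) := by
  have hg := U.gradient_ne_zero x hx
  obtain ⟨e, he⟩ : ∃ e : E3, e = ‖∇ U.φ x‖⁻¹ • ∇ U.φ x := ⟨_, rfl⟩
  have hn : 0 < ‖∇ U.φ x‖ := norm_pos_iff.2 hg
  have hfe : fderiv ℝ U.φ x e = ‖∇ U.φ x‖ := by
    rw [← inner_gradient_left, he, inner_smul_right, real_inner_self_eq_norm_sq]
    field_simp
  have hcont : Continuous fun y => fderiv ℝ U.φ y e :=
    (U.contDiff_φ.continuous_fderiv two_ne_zero).clm_apply continuous_const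
  -- In the unit gradient direction the derivative at `x` is the full gradient norm; half of it
  -- survives nearby.
  have hev : ∀ᶠ y in 𝓝 x, ‖∇ U.φ x‖ / 2 < fderiv ℝ U.φ y e :=
    hcont.continuousAt.eventually (lt_mem_nhds (by show _ < fderiv ℝ U.φ x e; rw [hfe]; linarith))
  obtain ⟨δ, hδ, hball⟩ := Metric.eventually_nhds_iff_ball.1 hev
  refine ⟨e, δ, hδ, ‖∇ U.φ x‖ / 2, by positivity, ?_, fun y hy s hs hys => ?_⟩
  · rw [he, norm_smul, norm_inv, norm_norm, inv_mul_cancel₀ hn.ne']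
  · have hline : ∀ t : ℝ, HasDerivAt (fun t : ℝ => U.φ (y + t • e)) (fderiv ℝ U.φ (y + t • e) e) t :=
      fun t => by
        have h1 : HasDerivAt (fun t : ℝ => y + t • e) e t := by
          simpa using ((hasDerivAt_id t).smul_const e).const_add y
        exact ((U.contDiff_φ.differentiable two_ne_zero) _).hasFDerivAt.comp_hasDerivAt t h1
    have hmem : ∀ t ∈ Icc 0 s, y + t • e ∈ ball x δ := fun t ht => by
      rcases eq_or_lt_of_le hs with rfl | hs'
      · have : t = 0 := le_antisymm ht.2 ht.1
        simpa [this] using hy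
      · have := (convex_ball x δ) hy hys (a := 1 - t / s) (b := t / s)
          (sub_nonneg.2 ((div_le_one hs').2 ht.2)) (div_nonneg ht.1 hs) (by ring)
        convert this using 1
        rw [smul_add, smul_smul, div_mul_cancel₀ _ hs'.ne']
        module
    have := (convex_Icc (0 : ℝ) s).mul_sub_le_image_sub_of_le_deriv
      (f := fun t : ℝ => U.φ (y + t • e)) (fun t _ => (hline t).continuousAt.continuousWithinAt)
      (fun t _ => (hline t).differentiableAt.differentiableWithinAt) (C := ‖∇ U.φ x‖ / 2)
      (fun t ht => by
        rw [(hline t).deriv]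
        exact (hball _ (hmem t (interior_subset ht))).le)
      0 (by simp [hs]) s (by simp [hs]) hs
    simp only [zero_smul, add_zero, sub_zero] at this
    linarith

/-- At a boundary point, moving against `e` decreases `φ`, so the part of a small ball inside `Ω`
slides, without leaving `Ω`, onto an interior ball which is already controlled. The nonvanishing
gradient enters the Poincaré inequality here. -/
theorem exists_gradControlled_nhds {x₀ : E3} {r₀ : ℝ} (hr₀ : 0 < r₀) (hB : ball x₀ r₀ ⊆ U.Ω)
    {x : E3} (hx : x ∈ closure U.Ω) :
    ∃ r > 0, GradControlled U.Ω (ball x₀ r₀) (ball x r ∩ U.Ω) := by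
  by_cases hxΩ : x ∈ U.Ω
  · obtain ⟨r, hr, hc⟩ := exists_gradControlled_ball U.isOpen U.connected hr₀ hB hxΩ
    exact ⟨r, hr, hc.mono inter_subset_left⟩
  have hx0 : U.φ x = 0 := U.phi_eq_zero_of_mem_frontier ⟨hx, by rwa [U.isOpen.interior_eq]⟩
  obtain ⟨e, δ, hδ, m, hm, he, hgrow⟩ := U.exists_direction hx0
  have hdown : ∀ y ∈ ball x (δ / 2), ∀ s ∈ Icc 0 (δ / 2), U.φ (y - s • e) + m * s ≤ U.φ y := by
    intro y hy s hs
    rw [mem_ball] at hy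
    have h1 : y - s • e ∈ ball x δ := by
      rw [mem_ball]
      calc dist (y - s • e) x ≤ dist (y - s • e) y + dist y x := dist_triangle _ _ _
        _ < δ := by
          rw [dist_eq_norm, sub_sub_cancel_left, norm_neg, norm_smul, he,
            Real.norm_of_nonneg hs.1]
          linarith [hs.2]
    have := hgrow (y - s • e) h1 s hs.1 (by simpa using ball_subset_ball (by linarith) hy)
    simpa using this
  have hyΩ : x - (δ / 2) • e ∈ U.Ω := by
    rw [U.eq_sublevel, mem_ofPred_eq]
    have := hdown x (mem_ball_self (by positivity)) (δ / 2) ⟨by positivity, le_rfl⟩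
    have h2 : 0 < m * (δ / 2) := by positivity
    linarith
  obtain ⟨ε, hε, hc⟩ := exists_gradControlled_ball U.isOpen U.connected hr₀ hB hyΩ
  refine ⟨min ε (δ / 2), by positivity, hc.translate U.isOpen measurableSet_ball
    (measurableSet_ball.inter U.isOpen.measurableSet) (k := -((δ / 2) • e)) ?_ ?_⟩
  · rintro z ⟨hz, -⟩
    have := ball_subset_ball (min_le_left _ _) hz
    rw [mem_ball, dist_eq_norm] at this ⊢
    rwa [show z + -((δ / 2) • e) - (x - (δ / 2) • e) = z - x by abel]
  · rintro z ⟨hz, hzΩ⟩ s hs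
    have := hdown z (ball_subset_ball (min_le_right _ _) hz) (s * (δ / 2))
      ⟨mul_nonneg hs.1 (by positivity), mul_le_of_le_one_left (by positivity) hs.2⟩
    rw [U.eq_sublevel, mem_ofPred_eq] at hzΩ ⊢
    have h2 : 0 ≤ m * (s * (δ / 2)) := mul_nonneg hm.le (mul_nonneg hs.1 (by positivity))
    rw [show z + s • -((δ / 2) • e) = z - (s * (δ / 2)) • e by rw [smul_neg, smul_smul]; abel]
    linarith

theorem gradControlled {x₀ : E3} {r₀ : ℝ} (hr₀ : 0 < r₀) (hB : ball x₀ r₀ ⊆ U.Ω) :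
    GradControlled U.Ω (ball x₀ r₀) U.Ω := by
  have : GradControlled U.Ω (ball x₀ r₀) (closure U.Ω ∩ U.Ω) := by
    refine U.isCompact_closure.induction_on (p := fun s => GradControlled U.Ω _ (s ∩ U.Ω))
      ⟨0, fun u _ => by simp⟩ (fun s t hst h => h.mono (by gcongr))
      (fun s t hs ht => by rw [union_inter_distrib_right]; exact hs.union ht) fun x hx => ?_
    obtain ⟨r, hr, hc⟩ := U.exists_gradControlled_nhds hr₀ hB hx
    exact ⟨ball x r, mem_nhdsWithin_of_mem_nhds (ball_mem_nhds x hr), hc⟩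
  exact this.mono fun x hx => ⟨subset_closure hx, hx⟩

/-- The Poincaré-Wirtinger inequality, with an unspecified constant in place of the mean. -/
theorem poincare : ∃ C : ℝ≥0, ∀ u : E3 → ℝ, ContDiffOn ℝ 1 u U.Ω →
    ∃ m : ℝ, ∫⁻ x in U.Ω, ‖u x - m‖ₑ ^ 2 ≤ C * ∫⁻ x in U.Ω, ‖fderiv ℝ u x‖ₑ ^ 2 := by
  obtain ⟨x₀, hx₀⟩ := U.connected.nonempty
  obtain ⟨r₀, hr₀, hB⟩ := Metric.isOpen_iff.1 U.isOpen x₀ hx₀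
  obtain ⟨C, hC⟩ := U.gradControlled hr₀ hB
  set B := ball x₀ r₀
  obtain ⟨R, hR⟩ : ∃ R, B ⊆ ball 0 R := isBounded_ball.subset_ball 0
  set K := ∫⁻ h in ball (0 : E3) (2 * R), ‖h‖ₑ ^ 2 with hK
  have hKtop : K ≠ ∞ := by
    refine ((setLIntegral_mono (g := fun _ => ENNReal.ofReal (2 * R) ^ 2) measurable_const
      fun h hh => ?_).trans_lt ?_).ne
    · rw [← ofReal_norm]
      gcongr
      exact (mem_ball_zero_iff.1 hh).le
    · rw [setLIntegral_const]
      exact ENNReal.mul_lt_top (by finiteness) measure_ball_lt_top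
  have hv0 : volume B ≠ 0 := (measure_ball_pos _ _ hr₀).ne'
  have hvt : volume B ≠ ∞ := measure_ball_lt_top.ne
  set L : ℝ≥0 := ((volume B)⁻¹ * K).toNNReal with hL
  have hLe : (L : ℝ≥0∞) = (volume B)⁻¹ * K :=
    ENNReal.coe_toNNReal (ENNReal.mul_ne_top (ENNReal.inv_ne_top.2 hv0) hKtop)
  -- The `+ 1` makes the constant nonzero, so that the right-hand side is `∞` when the Dirichlet
  -- energy is.
  refine ⟨C * (1 + L) + 1, fun u hu => ?_⟩
  set G := ∫⁻ x in U.Ω, ‖fderiv ℝ u x‖ₑ ^ 2 with hG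
  by_cases hGt : G = ∞
  · refine ⟨0, ?_⟩
    rw [hGt, ENNReal.mul_top (by positivity)]
    exact le_top
  have hdouble := lintegral_lintegral_sq_sub_le U.isOpen measurableSet_ball (convex_ball x₀ r₀)
    hB hR hu
  have hmeas : AEMeasurable (fun x => ∫⁻ y in B, ‖u y - u x‖ₑ ^ 2) (volume.restrict B) := by
    have hwm := measurable_indicator_of_contDiffOn U.isOpen hu
    refine ⟨fun x => ∫⁻ y in B, ‖U.Ω.indicator u y - U.Ω.indicator u x‖ₑ ^ 2, ?_, ?_⟩
    · exact Measurable.lintegral_prod_right' (f := fun p : E3 × E3 =>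
        ‖U.Ω.indicator u p.2 - U.Ω.indicator u p.1‖ₑ ^ 2)
        ((((hwm.comp measurable_snd).sub (hwm.comp measurable_fst)).enorm).pow_const 2)
    · refine (ae_restrict_iff' measurableSet_ball).2 (ae_of_all _ fun x hx => ?_)
      refine setLIntegral_congr_fun measurableSet_ball fun y hy => ?_
      simp only [indicator_of_mem (hB hx), indicator_of_mem (hB hy)]
  -- Some `y` does no worse than the average over `B`; its value `u y` plays the role of the mean.
  obtain ⟨y, hy, hle⟩ := exists_le_setLAverage hv0 hvt hmeas
  refine ⟨u y, ?_⟩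
  have hNL : ∫⁻ x in B, ‖u x - u y‖ₑ ^ 2 ≤ L * G := by
    rw [setLAverage_eq, ENNReal.div_eq_inv_mul] at hle
    refine hle.trans ?_
    rw [hLe, mul_assoc]
    gcongr
  have hd : ∀ x, fderiv ℝ (fun x => u x - u y) x = fderiv ℝ u x := fun x => fderiv_sub_const _
  have := hC (fun x => u x - u y) (hu.sub contDiffOn_const)
  simp only [hd] at this
  calc _ ≤ _ := this
    _ ≤ C * (G + L * G) := by gcongr
    _ = C * (1 + L) * G := by ring
    _ ≤ _ := by
      push_cast
      gcongr
      exact le_self_add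

end RegularDomain

end Poincare

/-! ### Divergence theorem for fields tangential to the boundary -/

section Divergence

open Metric Filter Topology

theorem integral_fderiv_apply_eq_zero {f : E3 → ℝ} (hf : ContDiff ℝ 1 f)
    (hc : HasCompactSupport f) (v : E3) : ∫ x, fderiv ℝ f x v = 0 := by
  have hcont : Continuous fun x => fderiv ℝ f x v :=
    (hf.continuous_fderiv one_ne_zero).clm_apply continuous_const
  have := integral_mul_fderiv_eq_neg_fderiv_mul_of_integrable (μ := (volume : Measure E3))
    (𝕜 := ℝ) (f := fun _ : E3 => (1 : ℝ)) (g := f) (v := v) (by simp)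
    (by simpa using hcont.integrable_of_hasCompactSupport (hc.fderiv_apply ℝ v))
    (by simpa using hf.continuous.integrable_of_hasCompactSupport hc)
    (fun _ _ => differentiableAt_const _)
    (fun x _ => hf.differentiable one_ne_zero x)
  simpa using this

theorem eq_sum_single (w : E3) : w = ∑ i, w i • EuclideanSpace.single i (1 : ℝ) := by
  ext j
  simp [Pi.single_apply]

theorem clm_apply_eq_sum (L : E3 →L[ℝ] ℝ) (w : E3) :
    L w = ∑ i, w i * L (EuclideanSpace.single i 1) := by
  conv_lhs => rw [eq_sum_single w]
  simp

theorem contDiffAt_coord {X : E3 → E3} {x : E3} {n : WithTop ℕ∞} (hX : ContDiffAt ℝ n X x)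
    (i : Fin 3) : ContDiffAt ℝ n (fun y => X y i) x :=
  (contDiffAt_piLp 2).1 hX i

theorem pd_mul {f g : E3 → ℝ} {x : E3} (hf : DifferentiableAt ℝ f x)
    (hg : DifferentiableAt ℝ g x) (i : Fin 3) :
    pd i (fun y => f y * g y) x = f x * pd i g x + pd i f x * g x := by
  unfold pd
  rw [fderiv_fun_mul hf hg]
  simp [mul_comm]

theorem dvg_smul {f : E3 → ℝ} {X : E3 → E3} {x : E3} (hf : DifferentiableAt ℝ f x)
    (hX : DifferentiableAt ℝ X x) :
    dvg (fun y => f y • X y) x = f x * dvg X x + fderiv ℝ f x (X x) := by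
  have hXi : ∀ i, DifferentiableAt ℝ (fun y => X y i) x := (differentiableAt_piLp 2).1 hX
  unfold dvg
  simp only [PiLp.smul_apply, smul_eq_mul, pd_mul hf (hXi _), Finset.sum_add_distrib,
    Finset.mul_sum]
  rw [clm_apply_eq_sum]
  simp only [pd, mul_comm]

theorem continuousAt_pd {f : E3 → ℝ} {x : E3} (hf : ContDiffAt ℝ 1 f x) (i : Fin 3) :
    ContinuousAt (pd i f) x :=
  (hf.continuousAt_fderiv one_ne_zero).clm_apply continuousAt_const

theorem continuousAt_dvg {X : E3 → E3} {x : E3} (hX : ContDiffAt ℝ 1 X x) :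
    ContinuousAt (dvg X) x :=
  tendsto_finsetSum _ fun i _ => continuousAt_pd (contDiffAt_coord hX i) i

theorem pd_congr {f g : E3 → ℝ} {x : E3} (h : f =ᶠ[𝓝 x] g) (i : Fin 3) : pd i f x = pd i g x := by
  unfold pd
  rw [h.fderiv_eq]

theorem dvg_congr {X Y : E3 → E3} {x : E3} (h : X =ᶠ[𝓝 x] Y) : dvg X x = dvg Y x :=
  Finset.sum_congr rfl fun i _ => pd_congr (h.mono fun y hy => by simp only [hy]) i

theorem integral_dvg_eq_zero_of_hasCompactSupport {X : E3 → E3} (hX : ContDiff ℝ 1 X)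
    (hc : HasCompactSupport X) : ∫ x, dvg X x = 0 := by
  have hXi : ∀ i, ContDiff ℝ 1 fun y => X y i := (contDiff_piLp 2).1 hX
  have hci : ∀ i, HasCompactSupport fun y => X y i := fun i =>
    hc.comp_left (g := fun w : E3 => w i) rfl
  unfold dvg
  rw [integral_finsetSum]
  · exact Finset.sum_eq_zero fun i _ => integral_fderiv_apply_eq_zero (hXi i) (hci i) _
  · intro i _
    exact (((hXi i).continuous_fderiv one_ne_zero).clm_apply
      continuous_const).integrable_of_hasCompactSupport ((hci i).fderiv_apply ℝ _)

namespace RegularDomain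

variable (U : RegularDomain)

/-- Stepping backwards along the growth direction makes `φ` negative, so a zero of `φ` is a limit of
points of `Ω`. With the converse above, the boundary is exactly the zero set. -/
theorem mem_frontier_of_phi_eq_zero {x : E3} (hx : U.φ x = 0) : x ∈ frontier U.Ω := by
  refine ⟨?_, ?_⟩
  · obtain ⟨e, δ, hδ, m, hm, he, hgrow⟩ := U.exists_direction hx
    refine Metric.mem_closure_iff.2 fun ε hε => ?_
    set s := min (ε / 2) (δ / 2) with hs
    have hs0 : 0 < s := by positivity
    have hd : dist x (x - s • e) = s := by
      rw [dist_eq_norm, sub_sub_cancel, norm_smul, he, Real.norm_of_nonneg hs0.le, mul_one]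
    refine ⟨x - s • e, ?_, ?_⟩
    · have := hgrow (x - s • e) (by
        rw [mem_ball, dist_comm, hd]; linarith [min_le_right (ε / 2) (δ / 2)]) s hs0.le
        (by simpa using hδ)
      rw [sub_add_cancel, hx] at this
      rw [U.eq_sublevel, mem_ofPred_eq]
      have : 0 < m * s := by positivity
      linarith
    · rw [hd]; linarith [min_le_left (ε / 2) (δ / 2)]
  · rw [U.isOpen.interior_eq, U.eq_sublevel, mem_ofPred_eq, hx]
    exact lt_irrefl _

theorem phi_neg {x : E3} (hx : x ∈ U.Ω) : U.φ x < 0 := by rwa [U.eq_sublevel] at hx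

/-- Near the boundary, a walk from `y` along `e` meets the zero set of `φ` within distance `|φ y| /
m`; there `g` vanishes, and `g` is locally Lipschitz. Near an interior point `|φ|` is bounded below.
Compactness of the closure patches the local constants. -/
theorem exists_abs_le_mul_abs_phi {g : E3 → ℝ} (hg : ∀ x ∈ closure U.Ω, ContDiffAt ℝ 1 g x)
    (h0 : ∀ x ∈ frontier U.Ω, g x = 0) : ∃ C, 0 ≤ C ∧ ∀ x ∈ U.Ω, |g x| ≤ C * |U.φ x| := by
  suffices H : ∃ C, 0 ≤ C ∧ ∀ x ∈ closure U.Ω ∩ U.Ω, |g x| ≤ C * |U.φ x| by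
    obtain ⟨C, hC, h⟩ := H
    exact ⟨C, hC, fun x hx => h x ⟨subset_closure hx, hx⟩⟩
  refine U.isCompact_closure.induction_on
    (p := fun s => ∃ C, 0 ≤ C ∧ ∀ x ∈ s ∩ U.Ω, |g x| ≤ C * |U.φ x|)
    ⟨0, le_rfl, by simp⟩ (fun s t hst ⟨C, hC, h⟩ => ⟨C, hC, fun x hx => h x ⟨hst hx.1, hx.2⟩⟩)
    (fun s t ⟨C, hC, h⟩ ⟨C', hC', h'⟩ => ⟨C + C', by positivity, ?_⟩) fun x hx => ?_
  · rintro x ⟨hx | hx, hxΩ⟩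
    · exact (h x ⟨hx, hxΩ⟩).trans (by gcongr; linarith)
    · exact (h' x ⟨hx, hxΩ⟩).trans (by gcongr; linarith)
  by_cases hxΩ : x ∈ U.Ω
  · have hφ := U.phi_neg hxΩ
    have hc1 : ContinuousAt (fun y => |g y|) x := (hg x hx).continuousAt.abs
    have hc2 : ContinuousAt U.φ x := U.contDiff_φ.continuous.continuousAt
    have hev : ∀ᶠ y in 𝓝 x, |g y| < |g x| + 1 ∧ U.φ y < U.φ x / 2 :=
      (hc1.eventually (gt_mem_nhds (by linarith))).and
        (hc2.eventually (gt_mem_nhds (by linarith)))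
    refine ⟨_, mem_nhdsWithin_of_mem_nhds hev, (|g x| + 1) / |U.φ x / 2|, by positivity, ?_⟩
    rintro y ⟨⟨h1, h2⟩, -⟩
    have hpos : 0 < |U.φ x / 2| := abs_pos.2 (by linarith)
    have h3 : |U.φ x / 2| ≤ |U.φ y| := by
      rw [abs_of_neg (by linarith), abs_of_neg (by linarith)]
      linarith
    calc |g y| ≤ |g x| + 1 := h1.le
      _ = (|g x| + 1) / |U.φ x / 2| * |U.φ x / 2| := by field_simp
      _ ≤ _ := by gcongr
  · have hx0 : U.φ x = 0 := U.phi_eq_zero_of_mem_frontier ⟨hx, by rwa [U.isOpen.interior_eq]⟩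
    obtain ⟨e, δ, hδ, m, hm, he, hgrow⟩ := U.exists_direction hx0
    obtain ⟨L, t, ht, hL⟩ := (hg x hx).exists_lipschitzOnWith
    obtain ⟨δ', hδ', hball⟩ := Metric.mem_nhds_iff.1 ht
    set r := min δ δ' with hr
    have hr0 : 0 < r := lt_min hδ hδ'
    have hc2 : ContinuousAt U.φ x := U.contDiff_φ.continuous.continuousAt
    have hmr : 0 < m * (r / 2) := by positivity
    have hev : ∀ᶠ y in 𝓝 x, y ∈ ball x (r / 2) ∧ -(m * (r / 2)) < U.φ y :=
      Filter.Eventually.and (ball_mem_nhds x (by positivity)) (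
        hc2.eventually (lt_mem_nhds (by rw [hx0]; linarith)))
    refine ⟨_, mem_nhdsWithin_of_mem_nhds hev, L / m, by positivity, ?_⟩
    rintro y ⟨⟨hy1, hy2⟩, hyΩ⟩
    have hφy := U.phi_neg hyΩ
    set S := |U.φ y| / m with hS
    have hS0 : 0 ≤ S := by positivity
    have hSr : S < r / 2 := by
      rw [hS, div_lt_iff₀ hm, abs_of_neg hφy]
      linarith
    have hseg : ∀ s ∈ Icc 0 S, y + s • e ∈ ball x r := fun s hs => by
      rw [mem_ball] at hy1 ⊢
      calc dist (y + s • e) x ≤ dist (y + s • e) y + dist y x := dist_triangle _ _ _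
        _ < r := by
          rw [dist_eq_norm, add_sub_cancel_left, norm_smul, he, Real.norm_of_nonneg hs.1]
          linarith [hs.2]
    have hyball : y ∈ ball x r := by simpa using hseg 0 ⟨le_rfl, hS0⟩
    have hend : 0 ≤ U.φ (y + S • e) := by
      have := hgrow y (ball_subset_ball (min_le_left _ _) hyball) S hS0
        (ball_subset_ball (min_le_left _ _) (hseg S ⟨hS0, le_rfl⟩))
      rw [hS, mul_div_cancel₀ _ hm.ne', abs_of_neg hφy] at this
      rw [hS, abs_of_neg hφy]
      linarith
    have hcont : ContinuousOn (fun s : ℝ => U.φ (y + s • e)) (Icc 0 S) :=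
      (U.contDiff_φ.continuous.comp (by fun_prop)).continuousOn
    obtain ⟨s, hs, hs0⟩ := intermediate_value_Icc hS0 hcont
      (show (0 : ℝ) ∈ Icc _ _ from ⟨by simpa using hφy.le, hend⟩)
    have hgz : g (y + s • e) = 0 := h0 _ (U.mem_frontier_of_phi_eq_zero hs0)
    have := hL.dist_le_mul y (hball (ball_subset_ball (min_le_right _ _) hyball)) (y + s • e)
      (hball (ball_subset_ball (min_le_right _ _) (hseg s hs)))
    rw [hgz, Real.dist_eq, sub_zero, dist_eq_norm, sub_add_cancel_left, norm_neg, norm_smul, he,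
      Real.norm_of_nonneg hs.1, mul_one] at this
    calc |g y| ≤ L * s := this
      _ ≤ L * S := by gcongr; exact hs.2
      _ = _ := by rw [hS]; ring

theorem integrableOn_of_continuousAt {f : E3 → ℝ} (hf : ∀ x ∈ closure U.Ω, ContinuousAt f x) :
    IntegrableOn f U.Ω :=
  (ContinuousOn.integrableOn_compact U.isCompact_closure
    fun x hx => (hf x hx).continuousWithinAt).mono_set subset_closure

/-- A cutoff function of `φ` which is supported in `Ω` and tends to `1` there as `n → ∞`. -/
noncomputable def cutoff (n : ℕ) (x : E3) : ℝ := Real.smoothTransition (-(n * U.φ x) - 1)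

theorem contDiff_cutoff (n : ℕ) : ContDiff ℝ 1 (U.cutoff n) :=
  Real.smoothTransition.contDiff.comp
    (((contDiff_const.mul (U.contDiff_φ.of_le one_le_two)).neg).sub contDiff_const)

theorem cutoff_eventually_zero (n : ℕ) {x : E3} (hx : x ∉ U.Ω) :
    ∀ᶠ y in 𝓝 x, U.cutoff n y = 0 := by
  rw [U.eq_sublevel, mem_ofPred_eq, not_lt] at hx
  have hc : ContinuousAt (fun y => -(n * U.φ y) - 1) x := by
    have := U.contDiff_φ.continuous
    fun_prop
  have : ∀ᶠ y in 𝓝 x, -(n * U.φ y) - 1 < 0 := hc.eventually (gt_mem_nhds (by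
    have : 0 ≤ n * U.φ x := by positivity
    linarith))
  exact this.mono fun y hy => Real.smoothTransition.zero_of_nonpos hy.le

theorem fderiv_cutoff_apply (n : ℕ) (x w : E3) : fderiv ℝ (U.cutoff n) x w =
    deriv Real.smoothTransition (-(n * U.φ x) - 1) * -(n * fderiv ℝ U.φ x w) := by
  have h1 : HasFDerivAt U.φ (fderiv ℝ U.φ x) x :=
    (U.contDiff_φ.differentiable two_ne_zero x).hasFDerivAt
  have h2 : HasDerivAt Real.smoothTransition (deriv Real.smoothTransition (-(n * U.φ x) - 1))
      (-(n * U.φ x) - 1) :=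
    ((Real.smoothTransition.contDiff (n := 1)).differentiable one_ne_zero _).hasDerivAt
  have h3 := h2.comp_hasFDerivAt x (((h1.const_mul (n : ℝ)).neg).sub_const 1)
  have : fderiv ℝ (U.cutoff n) x = _ := h3.fderiv
  rw [this]
  simp

end RegularDomain

theorem deriv_smoothTransition_eq_zero {s : ℝ} (hs : 1 < s) :
    deriv Real.smoothTransition s = 0 := by
  have : Real.smoothTransition =ᶠ[𝓝 s] fun _ => 1 :=
    (lt_mem_nhds hs).mono fun y hy => Real.smoothTransition.one_of_one_le (le_of_lt hy)
  rw [this.deriv_eq, deriv_const]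

/-- With `s = -n φ` this bounds `n |φ|` times the derivative of the cutoff profile uniformly in `n`.
The derivative vanishes once `s > 2`, which leaves a compact interval. -/
theorem exists_abs_deriv_smoothTransition_le :
    ∃ K, 0 ≤ K ∧ ∀ s, 0 ≤ s → |deriv Real.smoothTransition (s - 1)| * s ≤ K := by
  have hc : Continuous fun s : ℝ => |deriv Real.smoothTransition (s - 1)| * s :=
    (((Real.smoothTransition.contDiff (n := 1)).continuous_deriv le_rfl).comp
      (continuous_sub_right 1)).abs.mul continuous_id
  obtain ⟨K, hK⟩ := (isCompact_Icc (a := (0 : ℝ)) (b := 2)).bddAbove_image hc.continuousOn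
  refine ⟨max K 0, le_max_right _ _, fun s hs => ?_⟩
  by_cases h : s ≤ 2
  · exact le_max_of_le_left (hK ⟨s, ⟨hs, h⟩, rfl⟩)
  · rw [deriv_smoothTransition_eq_zero (by linarith)]
    simp

/-- The divergence theorem for a vector field which is tangential at the boundary. -/
theorem RegularDomain.integral_dvg_eq_zero (U : RegularDomain) {X : E3 → E3}
    (hX : ∀ x ∈ closure U.Ω, ContDiffAt ℝ 1 X x)
    (h0 : ∀ x ∈ frontier U.Ω, fderiv ℝ U.φ x (X x) = 0) : ∫ x in U.Ω, dvg X x = 0 := by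
  have hΩ := U.isOpen.measurableSet
  have hgC : ∀ x ∈ closure U.Ω, ContDiffAt ℝ 1 (fun x => fderiv ℝ U.φ x (X x)) x := fun x hx =>
    (U.contDiff_φ.contDiffAt.fderiv_right (by norm_num)).clm_apply (hX x hx)
  obtain ⟨C, hC0, hC⟩ := U.exists_abs_le_mul_abs_phi hgC h0
  obtain ⟨K, hK0, hK⟩ := exists_abs_deriv_smoothTransition_le
  have hdiv : ∀ n : ℕ, ∫ x in U.Ω, (U.cutoff n x * dvg X x + fderiv ℝ (U.cutoff n) x (X x)) = 0 := by
    intro n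
    have hev : ∀ x ∉ U.Ω, (fun y => U.cutoff n y • X y) =ᶠ[𝓝 x] fun _ => 0 := fun x hx =>
      (U.cutoff_eventually_zero n hx).mono fun y hy => by simp [hy]
    have hY : ContDiff ℝ 1 fun y => U.cutoff n y • X y := by
      refine contDiff_iff_contDiffAt.2 fun x => ?_
      by_cases hx : x ∈ closure U.Ω
      · exact (U.contDiff_cutoff n).contDiffAt.smul (hX x hx)
      · exact contDiffAt_const.congr_of_eventuallyEq (hev x fun h => hx (subset_closure h))
    have hYc : HasCompactSupport fun y => U.cutoff n y • X y :=
      HasCompactSupport.intro U.isCompact_closure fun x hx =>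
        (hev x fun h => hx (subset_closure h)).eq_of_nhds
    have hz : ∀ x ∉ U.Ω, dvg (fun y => U.cutoff n y • X y) x = 0 := fun x hx => by
      rw [dvg_congr (hev x hx)]
      simp [dvg, pd]
    rw [← integral_dvg_eq_zero_of_hasCompactSupport hY hYc,
      ← setIntegral_eq_integral_of_forall_compl_eq_zero (s := U.Ω) hz]
    refine setIntegral_congr_fun hΩ fun x hx => ?_
    exact (dvg_smul ((U.contDiff_cutoff n).differentiable one_ne_zero x)
      ((hX x (subset_closure hx)).differentiableAt one_ne_zero)).symm
  have hlim : Tendsto (fun n : ℕ => ∫ x in U.Ω,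
      (U.cutoff n x * dvg X x + fderiv ℝ (U.cutoff n) x (X x))) atTop
      (𝓝 (∫ x in U.Ω, dvg X x)) := by
    -- The cutoff gradient has size `n`, but only where `|φ|` is of order `1 / n`, and there the
    -- normal component of `X` is at most `C * |φ|`. The product stays below `K * C` and is
    -- eventually zero at each point of `Ω`.
    refine tendsto_integral_of_dominated_convergence (fun x => |dvg X x| + K * C) ?_ ?_ ?_ ?_
    · intro n
      refine (U.integrableOn_of_continuousAt fun x hx => ?_).aestronglyMeasurable
      exact ((U.contDiff_cutoff n).continuous.continuousAt.mul (continuousAt_dvg (hX x hx))).add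
        (((U.contDiff_cutoff n).continuous_fderiv one_ne_zero).continuousAt.clm_apply
          (hX x hx).continuousAt)
    · exact U.integrableOn_of_continuousAt fun x hx =>
        (continuousAt_dvg (hX x hx)).abs.add continuousAt_const
    · intro n
      refine (ae_restrict_iff' hΩ).2 (ae_of_all _ fun x hx => ?_)
      have hφ := U.phi_neg hx
      refine (norm_add_le _ _).trans (add_le_add ?_ ?_)
      · rw [norm_mul, Real.norm_eq_abs, Real.norm_eq_abs]
        refine mul_le_of_le_one_left (abs_nonneg _) ?_
        rw [cutoff, abs_of_nonneg (Real.smoothTransition.nonneg _)]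
        exact Real.smoothTransition.le_one _
      · rw [U.fderiv_cutoff_apply, Real.norm_eq_abs, abs_mul, abs_neg, abs_mul, Nat.abs_cast]
        calc _ ≤ |deriv Real.smoothTransition (-(n * U.φ x) - 1)| * (n * (C * |U.φ x|)) := by
              gcongr; exact hC x hx
          _ = |deriv Real.smoothTransition (-(n * U.φ x) - 1)| * -(n * U.φ x) * C := by
              rw [abs_of_neg hφ]; ring
          _ ≤ K * C := by
              gcongr
              refine hK _ ?_
              have : (n : ℝ) * U.φ x ≤ 0 := mul_nonpos_of_nonneg_of_nonpos (by positivity) hφ.le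
              linarith
    · refine (ae_restrict_iff' hΩ).2 (ae_of_all _ fun x hx => ?_)
      have hφ := U.phi_neg hx
      obtain ⟨N, hN⟩ := exists_nat_gt (2 / -U.φ x)
      refine tendsto_const_nhds.congr' ((eventually_ge_atTop N).mono fun n hn => ?_)
      have h2 : 2 < -(n * U.φ x) := by
        have h3 : (2 : ℝ) / -U.φ x < n := hN.trans_le (by exact_mod_cast hn)
        rw [div_lt_iff₀ (by linarith)] at h3
        linarith
      have e1 : U.cutoff n x = 1 := Real.smoothTransition.one_of_one_le (by linarith)
      simp only
      rw [U.fderiv_cutoff_apply, deriv_smoothTransition_eq_zero (by linarith), e1]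
      ring
  simp only [hdiv] at hlim
  exact tendsto_nhds_unique hlim tendsto_const_nhds |>.symm ▸ rfl

end Divergence

/-! ### Differential calculus in space-time and in coordinates -/

section Calculus

open Filter Topology

/-- A function of time and space is of class `C^n` near `(t, x)`. -/
abbrev SmoothAt {F : Type*} [NormedAddCommGroup F] [NormedSpace ℝ F] (n : WithTop ℕ∞)
    (f : ℝ → E3 → F) (t : ℝ) (x : E3) : Prop :=
  ContDiffAt ℝ n (fun z : ℝ × E3 => f z.1 z.2) (t, x)

variable {F : Type*} [NormedAddCommGroup F] [NormedSpace ℝ F] {n : WithTop ℕ∞} {t : ℝ} {x : E3}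

theorem SmoothAt.slice {f : ℝ → E3 → F} (hf : SmoothAt n f t x) : ContDiffAt ℝ n (f t) x :=
  ContDiffAt.comp x (g := fun z : ℝ × E3 => f z.1 z.2) (f := fun y => (t, y)) hf
    (contDiffAt_const.prodMk contDiffAt_id)

theorem SmoothAt.time {f : ℝ → E3 → F} (hf : SmoothAt n f t x) :
    ContDiffAt ℝ n (fun s => f s x) t :=
  ContDiffAt.comp t (g := fun z : ℝ × E3 => f z.1 z.2) (f := fun s => (s, x)) hf
    (contDiffAt_id.prodMk contDiffAt_const)

theorem SmoothAt.pd_eq {f : ℝ → E3 → ℝ} (hf : SmoothAt 1 f t x) (i : Fin 3) :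
    pd i (f t) x = fderiv ℝ (fun z : ℝ × E3 => f z.1 z.2) (t, x) (0, EuclideanSpace.single i 1) := by
  have h := (hf.differentiableAt one_ne_zero).hasFDerivAt
  have h2 : HasFDerivAt (fun y : E3 => (t, y)) (ContinuousLinearMap.inr ℝ ℝ E3) x :=
    hasFDerivAt_prodMk_right t x
  have h3 : HasFDerivAt (f t) _ x := h.comp x h2
  rw [pd, h3.fderiv]
  simp

theorem SmoothAt.hasDerivAt {f : ℝ → E3 → F} (hf : SmoothAt 1 f t x) :
    HasDerivAt (fun s => f s x) (fderiv ℝ (fun z : ℝ × E3 => f z.1 z.2) (t, x) (1, 0)) t := by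
  have h := (hf.differentiableAt one_ne_zero).hasFDerivAt
  have h2 : HasFDerivAt (fun s : ℝ => (s, x)) (ContinuousLinearMap.inl ℝ ℝ E3) t :=
    hasFDerivAt_prodMk_left t x
  have h3 := HasFDerivAt.comp (f := fun s : ℝ => (s, x)) t h h2
  simpa [Function.comp_def] using h3.hasDerivAt

theorem SmoothAt.eventually {f : ℝ → E3 → F} (hf : SmoothAt n f t x) (hn : n ≠ ((⊤ : ℕ∞) : WithTop ℕ∞)) :
    ∀ᶠ z in 𝓝 (t, x), SmoothAt n f z.1 z.2 :=
  ContDiffAt.eventually hf hn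

theorem SmoothAt.fderiv_apply {f : ℝ → E3 → F} (hf : SmoothAt 2 f t x) (w : ℝ × E3) :
    ContDiffAt ℝ 1 (fun z => fderiv ℝ (fun z : ℝ × E3 => f z.1 z.2) z w) (t, x) :=
  (hf.fderiv_right (by norm_num)).clm_apply contDiffAt_const

theorem SmoothAt.pd {f : ℝ → E3 → ℝ} (hf : SmoothAt 2 f t x) (i : Fin 3) :
    SmoothAt 1 (fun s y => pd i (f s) y) t x :=
  (hf.fderiv_apply (0, EuclideanSpace.single i 1)).congr_of_eventuallyEq <|
    (hf.eventually (by simp)).mono fun z hz =>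
      SmoothAt.pd_eq (ContDiffAt.of_le hz one_le_two) i

theorem SmoothAt.deriv {f : ℝ → E3 → F} (hf : SmoothAt 2 f t x) :
    SmoothAt 1 (fun s y => deriv (fun s' => f s' y) s) t x :=
  (hf.fderiv_apply (1, 0)).congr_of_eventuallyEq <|
    (hf.eventually (by simp)).mono fun z hz =>
      (SmoothAt.hasDerivAt (ContDiffAt.of_le hz one_le_two)).deriv

theorem fderiv_fderiv_apply {E : Type*} [NormedAddCommGroup E] [NormedSpace ℝ E] {g : E → F}
    {z : E} (hg : ContDiffAt ℝ 2 g z) (w w' : E) :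
    fderiv ℝ (fun z => fderiv ℝ g z w) z w' = fderiv ℝ (fderiv ℝ g) z w' w := by
  have h : DifferentiableAt ℝ (fderiv ℝ g) z :=
    (hg.fderiv_right (m := 1) (by norm_num)).differentiableAt one_ne_zero
  rw [fderiv_clm_apply h (differentiableAt_const w)]
  simp

theorem fderiv_fderiv_comm {E : Type*} [NormedAddCommGroup E] [NormedSpace ℝ E] {g : E → F}
    {z : E} (hg : ContDiffAt ℝ 2 g z) (w w' : E) :
    fderiv ℝ (fderiv ℝ g) z w w' = fderiv ℝ (fderiv ℝ g) z w' w :=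
  (hg.isSymmSndFDerivAt (by simp)).eq w w'

theorem pd_pd_comm {f : E3 → ℝ} (hf : ContDiffAt ℝ 2 f x) (i j : Fin 3) :
    pd i (pd j f) x = pd j (pd i f) x := by
  unfold GNSCH.pd
  rw [fderiv_fderiv_apply hf, fderiv_fderiv_apply hf, fderiv_fderiv_comm hf]

/-- Both sides are the second derivative of the joint function evaluated at `(1, 0)` and `(0, eᵢ)`,
so symmetry of second derivatives applies. -/
theorem SmoothAt.deriv_pd_comm {f : ℝ → E3 → ℝ} (hf : SmoothAt 2 f t x) (i : Fin 3) :
    _root_.deriv (fun s => GNSCH.pd i (f s) x) t =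
      GNSCH.pd i (fun y => _root_.deriv (fun s => f s y) t) x := by
  have hev := hf.eventually (by simp)
  rw [(hf.pd i).hasDerivAt.deriv, hf.deriv.pd_eq i]
  have h1 : (fun z : ℝ × E3 => GNSCH.pd i (f z.1) z.2) =ᶠ[𝓝 (t, x)] fun z =>
      fderiv ℝ (fun z : ℝ × E3 => f z.1 z.2) z (0, EuclideanSpace.single i 1) :=
    hev.mono fun z hz => SmoothAt.pd_eq (ContDiffAt.of_le hz one_le_two) i
  have h2 : (fun z : ℝ × E3 => _root_.deriv (fun s => f s z.2) z.1) =ᶠ[𝓝 (t, x)] fun z =>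
      fderiv ℝ (fun z : ℝ × E3 => f z.1 z.2) z (1, 0) :=
    hev.mono fun z hz => (SmoothAt.hasDerivAt (ContDiffAt.of_le hz one_le_two)).deriv
  rw [h1.fderiv_eq, h2.fderiv_eq, fderiv_fderiv_apply hf, fderiv_fderiv_apply hf,
    fderiv_fderiv_comm hf]

theorem laplacian_eq_sum_pd {f : E3 → ℝ} (hf : ContDiffAt ℝ 2 f x) :
    Δ f x = ∑ i, pd i (pd i f) x := by
  rw [InnerProductSpace.laplacian_eq_iteratedFDeriv_orthonormalBasis f
    (EuclideanSpace.basisFun (Fin 3) ℝ)]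
  refine Finset.sum_congr rfl fun i _ => ?_
  rw [iteratedFDeriv_two_apply]
  unfold GNSCH.pd
  rw [fderiv_fderiv_apply hf]
  simp

theorem gradient_apply (f : E3 → ℝ) (x : E3) (i : Fin 3) : ∇ f x i = pd i f x := by
  rw [pd, ← inner_gradient_left, EuclideanSpace.inner_single_right]
  simp

theorem norm_sq_eq_sum (w : E3) : ‖w‖ ^ 2 = ∑ i, w i ^ 2 := by
  simp [EuclideanSpace.norm_sq_eq]

theorem norm_gradient_sq (f : E3 → ℝ) (x : E3) : ‖∇ f x‖ ^ 2 = ∑ i, pd i f x ^ 2 := by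
  simp only [norm_sq_eq_sum, gradient_apply]

theorem norm_gradient (f : E3 → ℝ) (x : E3) : ‖∇ f x‖ = ‖fderiv ℝ f x‖ :=
  (InnerProductSpace.toDual ℝ E3).symm.norm_map _

theorem contDiffAt_gradient {f : E3 → ℝ} (hf : ContDiffAt ℝ 2 f x) : ContDiffAt ℝ 1 (∇ f) x :=
  (InnerProductSpace.toDual ℝ E3).symm.toContinuousLinearEquiv.contDiff.contDiffAt.comp x
    (hf.fderiv_right (m := 1) (by norm_num))

theorem contDiffAt_pd {f : E3 → ℝ} (hf : ContDiffAt ℝ 2 f x) (i : Fin 3) :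
    ContDiffAt ℝ 1 (pd i f) x :=
  (hf.fderiv_right (m := 1) (by norm_num)).clm_apply contDiffAt_const

section ChainRule

variable {Ψ : ℝ → ℝ → ℝ} {r s : ℝ}

/-- Written with one-variable derivatives because `p` and `dcψ₀` are defined through them. -/
theorem hasFDerivAt_uncurry
    (h : DifferentiableAt ℝ (fun z : ℝ × ℝ => Ψ z.1 z.2) (r, s)) :
    HasFDerivAt (fun z : ℝ × ℝ => Ψ z.1 z.2)
      (_root_.deriv (fun r' => Ψ r' s) r • ContinuousLinearMap.fst ℝ ℝ ℝ +
        _root_.deriv (fun s' => Ψ r s') s • ContinuousLinearMap.snd ℝ ℝ ℝ) (r, s) := by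
  have h0 := h.hasFDerivAt
  have h1 := (HasFDerivAt.comp (f := fun r' : ℝ => (r', s)) r h0
    (hasFDerivAt_prodMk_left r s)).hasDerivAt.deriv
  have h2 := (HasFDerivAt.comp (f := fun s' : ℝ => (r, s')) s h0
    (hasFDerivAt_prodMk_right r s)).hasDerivAt.deriv
  simp only [Function.comp_def] at h1 h2
  rw [h1, h2]
  convert h0 using 1
  ext <;> simp

theorem pd_comp₂ {f g : E3 → ℝ}
    (h : DifferentiableAt ℝ (fun z : ℝ × ℝ => Ψ z.1 z.2) (f x, g x))
    (hf : DifferentiableAt ℝ f x) (hg : DifferentiableAt ℝ g x) (i : Fin 3) :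
    pd i (fun y => Ψ (f y) (g y)) x = _root_.deriv (fun r' => Ψ r' (g x)) (f x) * pd i f x +
      _root_.deriv (fun s' => Ψ (f x) s') (g x) * pd i g x := by
  have := HasFDerivAt.comp (f := fun y => (f y, g y)) x (hasFDerivAt_uncurry h)
    (hf.hasFDerivAt.prodMk hg.hasFDerivAt)
  simp only [Function.comp_def] at this
  unfold GNSCH.pd
  rw [this.fderiv]
  simp

theorem hasDerivAt_comp₂ {f g : ℝ → ℝ} {f' g' t : ℝ}
    (h : DifferentiableAt ℝ (fun z : ℝ × ℝ => Ψ z.1 z.2) (f t, g t))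
    (hf : HasDerivAt f f' t) (hg : HasDerivAt g g' t) :
    HasDerivAt (fun y => Ψ (f y) (g y)) (_root_.deriv (fun r' => Ψ r' (g t)) (f t) * f' +
      _root_.deriv (fun s' => Ψ (f t) s') (g t) * g') t := by
  have := HasFDerivAt.comp_hasDerivAt t (f := fun y => (f y, g y)) (hasFDerivAt_uncurry h)
    (hf.prodMk hg)
  simpa [Function.comp_def] using this

end ChainRule

theorem pd_add {f g : E3 → ℝ} (hf : DifferentiableAt ℝ f x) (hg : DifferentiableAt ℝ g x)
    (i : Fin 3) : pd i (fun y => f y + g y) x = pd i f x + pd i g x := by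
  unfold GNSCH.pd
  rw [fderiv_fun_add hf hg]
  rfl

theorem pd_sub {f g : E3 → ℝ} (hf : DifferentiableAt ℝ f x) (hg : DifferentiableAt ℝ g x)
    (i : Fin 3) : pd i (fun y => f y - g y) x = pd i f x - pd i g x := by
  unfold GNSCH.pd
  rw [fderiv_fun_sub hf hg]
  rfl

theorem pd_const_mul {f : E3 → ℝ} (a : ℝ) (hf : DifferentiableAt ℝ f x)
    (i : Fin 3) : pd i (fun y => a * f y) x = a * pd i f x := by
  unfold GNSCH.pd
  rw [fderiv_const_mul hf]
  rfl

theorem pd_sum {ι : Type*} {S : Finset ι} {f : ι → E3 → ℝ}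
    (hf : ∀ k ∈ S, DifferentiableAt ℝ (f k) x) (i : Fin 3) :
    pd i (fun y => ∑ k ∈ S, f k y) x = ∑ k ∈ S, pd i (f k) x := by
  unfold GNSCH.pd
  rw [fderiv_fun_sum hf]
  simp

theorem pd_sq {f : E3 → ℝ} (hf : DifferentiableAt ℝ f x) (i : Fin 3) :
    pd i (fun y => f y ^ 2) x = 2 * (f x * pd i f x) := by
  simp only [pow_two]
  rw [pd_mul hf hf]
  ring

theorem dvg_add {X Y : E3 → E3} (hX : DifferentiableAt ℝ X x) (hY : DifferentiableAt ℝ Y x) :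
    dvg (fun y => X y + Y y) x = dvg X x + dvg Y x := by
  unfold dvg
  rw [← Finset.sum_add_distrib]
  exact Finset.sum_congr rfl fun i _ =>
    pd_add ((differentiableAt_piLp 2).1 hX i) ((differentiableAt_piLp 2).1 hY i) i

theorem dvg_sub {X Y : E3 → E3} (hX : DifferentiableAt ℝ X x) (hY : DifferentiableAt ℝ Y x) :
    dvg (fun y => X y - Y y) x = dvg X x - dvg Y x := by
  unfold dvg
  rw [← Finset.sum_sub_distrib]
  exact Finset.sum_congr rfl fun i _ =>
    pd_sub ((differentiableAt_piLp 2).1 hX i) ((differentiableAt_piLp 2).1 hY i) i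

theorem dvg_gradient {f : E3 → ℝ} (hf : ContDiffAt ℝ 2 f x) : dvg (∇ f) x = Δ f x := by
  rw [laplacian_eq_sum_pd hf]
  unfold dvg
  simp only [gradient_apply]

end Calculus

/-! ### Regularity of the constitutive laws; capillary and viscous stresses -/

section Energy

open Filter Topology

variable {t : ℝ} {x : E3}

namespace Model

variable {M : Model} {r s : ℝ}

theorem Regular.contDiffAt_ψe (hM : M.Regular) (hr : 0 < r) : ContDiffAt ℝ 2 M.ψe r :=
  hM.ψe.contDiffAt (Ioi_mem_nhds hr)

theorem Regular.contDiffAt_ψ₀ (hM : M.Regular) (hr : 0 < r) :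
    ContDiffAt ℝ 1 (fun z : ℝ × ℝ => M.ψ₀ z.1 z.2) (r, s) := by
  have h1 : ContDiffAt ℝ 1 (fun z : ℝ × ℝ => M.ψe z.1) (r, s) :=
    ContDiffAt.comp (r, s) (g := M.ψe) ((hM.contDiffAt_ψe hr).of_le one_le_two) contDiffAt_fst
  have h2 : ContDiffAt ℝ 1 (fun z : ℝ × ℝ => M.H z.2) (r, s) :=
    hM.H.contDiffAt.comp (r, s) contDiffAt_snd
  have h3 : ContDiffAt ℝ 1 (fun z : ℝ × ℝ => M.Q z.2) (r, s) :=
    hM.Q.contDiffAt.comp (r, s) contDiffAt_snd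
  have h4 : ContDiffAt ℝ 1 (fun z : ℝ × ℝ => Real.log z.1) (r, s) :=
    contDiffAt_fst.log hr.ne'
  exact (h1.add (h2.mul h4)).add h3

theorem Regular.deriv_ψ₀ (hM : M.Regular) (hr : 0 < r) :
    deriv (fun r' => M.ψ₀ r' s) r = deriv M.ψe r + M.H s * r⁻¹ := by
  have h1 : HasDerivAt M.ψe (deriv M.ψe r) r :=
    ((hM.contDiffAt_ψe hr).differentiableAt two_ne_zero).hasDerivAt
  exact ((h1.add ((Real.hasDerivAt_log hr.ne').const_mul (M.H s))).add_const (M.Q s)).deriv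

theorem Regular.dcψ₀_eq (hM : M.Regular) (r s : ℝ) :
    M.dcψ₀ r s = deriv M.H s * Real.log r + deriv M.Q s := by
  have h1 : HasDerivAt M.H (deriv M.H s) s := (hM.H.differentiable one_ne_zero s).hasDerivAt
  have h2 : HasDerivAt M.Q (deriv M.Q s) s := (hM.Q.differentiable one_ne_zero s).hasDerivAt
  have := (((h1.mul_const (Real.log r)).const_add (M.ψe r)).add h2).deriv
  exact this

/-- The pressure already contains one derivative of `ψe`; this is where its second derivative is
needed. -/
theorem Regular.contDiffAt_p (hM : M.Regular) (hr : 0 < r) :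
    ContDiffAt ℝ 1 (fun z : ℝ × ℝ => M.p z.1 z.2) (r, s) := by
  have h1 : ContDiffAt ℝ 1 (fun z : ℝ × ℝ => deriv M.ψe z.1) (r, s) := by
    refine ContDiffAt.comp (r, s) (g := deriv M.ψe) ?_ contDiffAt_fst
    exact ((hM.contDiffAt_ψe hr).fderiv_right (m := 1) (by norm_num)).clm_apply contDiffAt_const
  have h2 : ContDiffAt ℝ 1 (fun z : ℝ × ℝ => M.H z.2) (r, s) :=
    hM.H.contDiffAt.comp (r, s) contDiffAt_snd
  have h3 : ContDiffAt ℝ 1 (fun z : ℝ × ℝ => z.1 ^ 2 * (deriv M.ψe z.1 + M.H z.2 * z.1⁻¹))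
      (r, s) :=
    (contDiffAt_fst.pow 2).mul (h1.add (h2.mul (contDiffAt_fst.inv hr.ne')))
  refine h3.congr_of_eventuallyEq ?_
  have : ∀ᶠ z : ℝ × ℝ in 𝓝 (r, s), 0 < z.1 :=
    continuousAt_fst.eventually (lt_mem_nhds hr)
  exact this.mono fun z hz => by simp only [p, hM.deriv_ψ₀ hz]

theorem Regular.continuousAt_κ (hM : M.Regular) (hr : 0 < r) :
    ContinuousAt (fun z : ℝ × ℝ => M.κ z.1 z.2) (r, s) :=
  hM.κ.continuousAt ((isOpen_Ioi.prod isOpen_univ).mem_nhds ⟨hr, mem_univ _⟩)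

end Model

/-- The convective form of a transport term. -/
theorem transport_eq {ρ f : ℝ → E3 → ℝ} {v : ℝ → E3 → E3} (hρ : SmoothAt 1 ρ t x)
    (hf : SmoothAt 1 f t x) (hv : SmoothAt 1 v t x)
    (mass : deriv (fun s => ρ s x) t + dvg (fun y => ρ t y • v t y) x = 0) :
    deriv (fun s => ρ s x * f s x) t + dvg (fun y => (ρ t y * f t y) • v t y) x =
      ρ t x * (deriv (fun s => f s x) t + ∑ j, v t x j * pd j (f t) x) := by
  have h1 : DifferentiableAt ℝ (ρ t) x := hρ.slice.differentiableAt one_ne_zero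
  have h2 : DifferentiableAt ℝ (f t) x := hf.slice.differentiableAt one_ne_zero
  have h3 : DifferentiableAt ℝ (v t) x := hv.slice.differentiableAt one_ne_zero
  have e1 : (fun y => (ρ t y * f t y) • v t y) = fun y => f t y • (ρ t y • v t y) := by
    ext y; simp; ring
  rw [e1, dvg_smul h2 (h1.fun_smul h3), deriv_fun_mul (hρ.time.differentiableAt one_ne_zero)
    (hf.time.differentiableAt one_ne_zero), map_smul, smul_eq_mul, clm_apply_eq_sum]
  simp only [pd]
  linear_combination f t x * mass

/-- The divergence of the capillary stress is `Δc ∇c`. -/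
theorem capillary_eq {c : E3 → ℝ} (hc : ContDiffAt ℝ 2 c x) (i : Fin 3) :
    ∑ j, pd j (fun y => pd i c y * pd j c y - (if i = j then ‖∇ c y‖ ^ 2 / 2 else 0)) x =
      pd i c x * Δ c x := by
  have hd : ∀ k, DifferentiableAt ℝ (pd k c) x := fun k =>
    (contDiffAt_pd hc k).differentiableAt one_ne_zero
  have hn : DifferentiableAt ℝ (fun y => ∑ k, pd k c y ^ 2) x :=
    DifferentiableAt.fun_sum fun k _ => (hd k).pow 2
  have h1 : ∀ j, pd j (fun y => pd i c y * pd j c y -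
      (if i = j then ‖∇ c y‖ ^ 2 / 2 else 0)) x =
      pd i c x * pd j (pd j c) x + pd j (pd i c) x * pd j c x -
        (if i = j then ∑ k, pd k c x * pd i (pd k c) x else 0) := by
    intro j
    rw [pd_sub ((hd i).fun_mul (hd j)), pd_mul (hd i) (hd j)]
    · congr 1
      split_ifs with hij
      · subst hij
        have e : (fun y => ‖∇ c y‖ ^ 2 / 2) = fun y => 1 / 2 * ∑ k, pd k c y ^ 2 := by
          ext y; rw [norm_gradient_sq]; ring
        rw [e, pd_const_mul _ hn, pd_sum fun k _ => (hd k).fun_pow 2]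
        simp only [pd_sq (hd _), ← Finset.mul_sum]
        ring
      · simp [pd]
    · split_ifs
      · simp only [norm_gradient_sq, div_eq_mul_inv]
        exact hn.mul_const _
      · exact differentiableAt_const _
  simp only [h1, laplacian_eq_sum_pd hc, Finset.sum_sub_distrib, Finset.sum_add_distrib,
    Finset.sum_ite_eq, Finset.mem_univ, if_true, Finset.mul_sum]
  -- Symmetry of the Hessian identifies `∑ ∂ⱼ∂ᵢc ∂ⱼc` with the gradient of `|∇c|² / 2`, and the two
  -- cancel.
  simp only [pd_pd_comm hc i]
  simp only [mul_comm, add_sub_cancel_right]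

/-- The viscous stress tensor `ν(c)(∇v + ∇vᵀ) - ⅔ ν(c) div v I`. -/
noncomputable def stress (M : Model) (v : E3 → E3) (c : E3 → ℝ) (i j : Fin 3) (y : E3) : ℝ :=
  M.ν (c y) * (pd j (fun z => v z i) y + pd i (fun z => v z j) y)
    - (if i = j then 2 / 3 * (M.ν (c y) * dvg v y) else 0)

theorem contDiffAt_dvg {v : E3 → E3} (hv : ContDiffAt ℝ 2 v x) : ContDiffAt ℝ 1 (dvg v) x := by
  unfold dvg
  exact ContDiffAt.sum fun i _ => contDiffAt_pd (contDiffAt_coord hv i) i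

theorem contDiffAt_stress {M : Model} (hM : M.Regular) {v : E3 → E3} {c : E3 → ℝ}
    (hv : ContDiffAt ℝ 2 v x) (hc : ContDiffAt ℝ 1 c x) (i j : Fin 3) :
    ContDiffAt ℝ 1 (stress M v c i j) x := by
  have hν : ContDiffAt ℝ 1 (fun y => M.ν (c y)) x := hM.ν.contDiffAt.comp x hc
  refine (hν.mul ((contDiffAt_pd (contDiffAt_coord hv i) j).add
    (contDiffAt_pd (contDiffAt_coord hv j) i))).sub ?_
  split_ifs
  · exact contDiffAt_const.mul (hν.mul (contDiffAt_dvg hv))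
  · exact contDiffAt_const

theorem sum_pd_stress {M : Model} (hM : M.Regular) {v : E3 → E3} {c : E3 → ℝ}
    (hv : ContDiffAt ℝ 2 v x) (hc : ContDiffAt ℝ 1 c x) (i : Fin 3) :
    ∑ j, pd j (stress M v c i j) x =
      ∑ j, pd j (fun y => M.ν (c y) * (pd j (fun z => v z i) y + pd i (fun z => v z j) y)) x
        - 2 / 3 * pd i (fun y => M.ν (c y) * dvg v y) x := by
  have hν : ContDiffAt ℝ 1 (fun y => M.ν (c y)) x := hM.ν.contDiffAt.comp x hc
  have h1 : DifferentiableAt ℝ (fun y => M.ν (c y) * dvg v y) x :=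
    (hν.mul (contDiffAt_dvg hv)).differentiableAt one_ne_zero
  have h2 : ∀ j, pd j (stress M v c i j) x =
      pd j (fun y => M.ν (c y) * (pd j (fun z => v z i) y + pd i (fun z => v z j) y)) x -
        (if i = j then 2 / 3 * pd i (fun y => M.ν (c y) * dvg v y) x else 0) := by
    intro j
    unfold stress
    rw [pd_sub ((hν.mul ((contDiffAt_pd (contDiffAt_coord hv i) j).add
      (contDiffAt_pd (contDiffAt_coord hv j) i))).differentiableAt one_ne_zero)]
    · congr 1
      split_ifs with hij
      · rw [pd_const_mul _ h1, hij]
      · simp [pd]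
    · split_ifs
      · exact h1.const_mul _
      · exact differentiableAt_const _
  simp [h2, Finset.sum_sub_distrib]

/-- The power of the stress is the viscous dissipation density. -/
theorem sum_stress_mul_pd (M : Model) (v : E3 → E3) (c : E3 → ℝ) :
    ∑ i, ∑ j, stress M v c i j x * pd i (fun z => v z j) x =
      M.ν (c x) / 2 * deviatoricSq v x := by
  -- The stress is symmetric and, in dimension three, trace-free, so only the deviatoric symmetric
  -- part of `∇v` contributes; the factor `1 / 2` comes from symmetrizing.
  simp only [stress, deviatoricSq, dvg, Fin.sum_univ_three]
  norm_num [Fin.ext_iff]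
  ring

theorem stress_comm (M : Model) (v : E3 → E3) (c : E3 → ℝ) (i j : Fin 3) :
    stress M v c i j = stress M v c j i := by
  ext y
  simp only [stress, eq_comm (a := i), add_comm]

/-- The vector field `S v`. -/
noncomputable def stressWork (M : Model) (v : E3 → E3) (c : E3 → ℝ) (y : E3) : E3 :=
  WithLp.toLp 2 fun i => ∑ j, stress M v c i j y * v y j

theorem contDiffAt_stressWork {M : Model} (hM : M.Regular) {v : E3 → E3} {c : E3 → ℝ}
    (hv : ContDiffAt ℝ 2 v x) (hc : ContDiffAt ℝ 1 c x) :
    ContDiffAt ℝ 1 (stressWork M v c) x := by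
  refine (contDiffAt_piLp 2).2 fun i => ?_
  simp only [stressWork]
  exact ContDiffAt.sum fun j _ => (contDiffAt_stress hM hv hc i j).mul
    ((contDiffAt_coord hv j).of_le one_le_two)

theorem dvg_stressWork {M : Model} (hM : M.Regular) {v : E3 → E3} {c : E3 → ℝ}
    (hv : ContDiffAt ℝ 2 v x) (hc : ContDiffAt ℝ 1 c x) :
    dvg (stressWork M v c) x = ∑ i, v x i * ∑ j, pd j (stress M v c i j) x +
      M.ν (c x) / 2 * deviatoricSq v x := by
  have hS : ∀ i j, DifferentiableAt ℝ (stress M v c i j) x := fun i j =>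
    (contDiffAt_stress hM hv hc i j).differentiableAt one_ne_zero
  have hvj : ∀ j, DifferentiableAt ℝ (fun y => v y j) x := fun j =>
    (contDiffAt_coord hv j).differentiableAt two_ne_zero
  rw [← sum_stress_mul_pd]
  have h1 : ∀ i, pd i (fun y => stressWork M v c y i) x =
      ∑ j, stress M v c i j x * pd i (fun y => v y j) x +
        ∑ j, pd i (stress M v c i j) x * v x j := fun i => by
    simp only [stressWork]
    rw [pd_sum fun j _ => (hS i j).fun_mul (hvj j), ← Finset.sum_add_distrib]
    exact Finset.sum_congr rfl fun j _ => pd_mul (hS i j) (hvj j) i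
  rw [dvg]
  simp only [h1, Finset.sum_add_distrib]
  rw [add_comm]
  congr 1
  rw [Finset.sum_comm]
  refine Finset.sum_congr rfl fun i _ => ?_
  rw [Finset.mul_sum]
  refine Finset.sum_congr rfl fun j _ => ?_
  rw [stress_comm, mul_comm]

end Energy

/-! ### The pointwise energy balance -/

section Identity

open Filter Topology

variable {M : Model} {U : RegularDomain} {T : ℝ} {ρ : ℝ → E3 → ℝ} {v : ℝ → E3 → E3}
  {c μ : ℝ → E3 → ℝ} {t : ℝ} {x : E3}

theorem SmoothAt.of_le {F : Type*} [NormedAddCommGroup F] [NormedSpace ℝ F] {m n : WithTop ℕ∞}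
    {f : ℝ → E3 → F} (hf : SmoothAt n f t x) (h : m ≤ n) : SmoothAt m f t x :=
  ContDiffAt.of_le hf h

theorem SmoothAt.coord {n : WithTop ℕ∞} (hv : SmoothAt n v t x) (i : Fin 3) :
    SmoothAt n (fun s y => v s y i) t x :=
  (contDiffAt_piLp 2).1 hv i

/-- The energy per unit mass without its gradient part. -/
noncomputable def massEnergy (M : Model) (ρ : E3 → ℝ) (v : E3 → E3) (c : E3 → ℝ) (y : E3) : ℝ :=
  (∑ i, v y i ^ 2) / 2 + M.ψ₀ (ρ y) (c y)

theorem energyDensity_eq (M : Model) (ρ : E3 → ℝ) (v : E3 → E3) (c : E3 → ℝ) (y : E3) :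
    energyDensity M ρ v c y = ρ y * massEnergy M ρ v c y + M.γ / 2 * ∑ i, pd i c y ^ 2 := by
  rw [energyDensity, massEnergy, norm_gradient_sq, norm_sq_eq_sum]
  ring

theorem smoothAt_comp₂ {Ψ : ℝ → ℝ → ℝ} {n : WithTop ℕ∞} {f g : ℝ → E3 → ℝ}
    (h : ContDiffAt ℝ n (fun z : ℝ × ℝ => Ψ z.1 z.2) (f t x, g t x)) (hf : SmoothAt n f t x)
    (hg : SmoothAt n g t x) : SmoothAt n (fun s y => Ψ (f s y) (g s y)) t x :=
  ContDiffAt.comp (t, x) (g := fun z : ℝ × ℝ => Ψ z.1 z.2) h (ContDiffAt.prodMk hf hg)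

theorem smoothAt_massEnergy (hM : M.Regular) (hρ : SmoothAt 1 ρ t x) (hpos : 0 < ρ t x)
    (hv : SmoothAt 1 v t x) (hc : SmoothAt 1 c t x) :
    SmoothAt 1 (fun s y => massEnergy M (ρ s) (v s) (c s) y) t x :=
  ((ContDiffAt.sum fun i _ => (hv.coord i).pow 2).div_const 2).add
    (smoothAt_comp₂ (hM.contDiffAt_ψ₀ hpos) hρ hc)

theorem smoothAt_energyDensity (hM : M.Regular) (hρ : SmoothAt 2 ρ t x) (hpos : 0 < ρ t x)
    (hv : SmoothAt 2 v t x) (hc : SmoothAt 2 c t x) :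
    SmoothAt 1 (fun s y => energyDensity M (ρ s) (v s) (c s) y) t x := by
  simp only [energyDensity_eq]
  exact (ContDiffAt.mul (hρ.of_le one_le_two) (smoothAt_massEnergy hM (hρ.of_le one_le_two) hpos
    (hv.of_le one_le_two) (hc.of_le one_le_two))).add
    (contDiffAt_const.mul (ContDiffAt.sum fun i _ => (hc.pd i).pow 2))

/-- The total energy flux. -/
noncomputable def flux (M : Model) (ρ : ℝ → E3 → ℝ) (v : ℝ → E3 → E3) (c μ : ℝ → E3 → ℝ) (t : ℝ)
    (y : E3) : E3 :=
  (μ t y • (M.b (c t y) • ∇ (μ t) y) + (M.γ * deriv (fun s => c s y) t) • ∇ (c t) y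
    + stressWork M (v t) (c t) y) - ((ρ t y * massEnergy M (ρ t) (v t) (c t) y) • v t y
    + M.p (ρ t y) (c t y) • v t y)

theorem deriv_massEnergy (hM : M.Regular) (hρ : SmoothAt 1 ρ t x) (hpos : 0 < ρ t x)
    (hv : SmoothAt 1 v t x) (hc : SmoothAt 1 c t x) :
    deriv (fun s => massEnergy M (ρ s) (v s) (c s) x) t =
      ∑ i, v t x i * deriv (fun s => v s x i) t +
        (deriv (fun r => M.ψ₀ r (c t x)) (ρ t x) * deriv (fun s => ρ s x) t +
          M.dcψ₀ (ρ t x) (c t x) * deriv (fun s => c s x) t) := by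
  have h1 : ∀ i, HasDerivAt (fun s => v s x i ^ 2)
      (2 * (v t x i * deriv (fun s => v s x i) t)) t := fun i => by
    have := (((hv.coord i).time.differentiableAt one_ne_zero).hasDerivAt).fun_pow 2
    exact this.congr_deriv (by push_cast; ring)
  have h2 := hasDerivAt_comp₂ (Ψ := M.ψ₀) (t := t) (f := fun s => ρ s x) (g := fun s => c s x)
    ((hM.contDiffAt_ψ₀ hpos).differentiableAt one_ne_zero)
    (hρ.time.differentiableAt one_ne_zero).hasDerivAt
    (hc.time.differentiableAt one_ne_zero).hasDerivAt
  have h3 := ((HasDerivAt.fun_sum (u := Finset.univ) fun i _ => h1 i).div_const 2).add h2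
  have h4 := h3.deriv
  rw [← Finset.mul_sum] at h4
  simp only [massEnergy]
  refine h4.trans ?_
  simp only [Model.dcψ₀]
  ring

theorem pd_massEnergy (hM : M.Regular) {ρ : E3 → ℝ} {v : E3 → E3} {c : E3 → ℝ}
    (hρ : ContDiffAt ℝ 1 ρ x) (hpos : 0 < ρ x)
    (hv : ContDiffAt ℝ 1 v x) (hc : ContDiffAt ℝ 1 c x) (j : Fin 3) :
    pd j (massEnergy M ρ v c) x = ∑ i, v x i * pd j (fun y => v y i) x +
        (deriv (fun r => M.ψ₀ r (c x)) (ρ x) * pd j ρ x +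
          M.dcψ₀ (ρ x) (c x) * pd j c x) := by
  have hvi : ∀ i, DifferentiableAt ℝ (fun y => v y i) x := fun i =>
    (contDiffAt_coord hv i).differentiableAt one_ne_zero
  have hρ' := hρ.differentiableAt one_ne_zero
  have hc' := hc.differentiableAt one_ne_zero
  have hψ : DifferentiableAt ℝ (fun z : ℝ × ℝ => M.ψ₀ z.1 z.2) (ρ x, c x) :=
    (hM.contDiffAt_ψ₀ hpos).differentiableAt one_ne_zero
  have hψ' : DifferentiableAt ℝ (fun y => M.ψ₀ (ρ y) (c y)) x :=
    DifferentiableAt.comp x (g := fun z : ℝ × ℝ => M.ψ₀ z.1 z.2) (f := fun y => (ρ y, c y)) hψ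
      (hρ'.prodMk hc')
  have hsum : DifferentiableAt ℝ (fun y => ∑ i, v y i ^ 2) x :=
    DifferentiableAt.fun_sum fun i _ => (hvi i).fun_pow 2
  have e : massEnergy M ρ v c = fun y => 1 / 2 * ∑ i, v y i ^ 2 + M.ψ₀ (ρ y) (c y) := by
    ext y; rw [massEnergy]; ring
  rw [e, pd_add (hsum.const_mul _) hψ', pd_const_mul _ hsum, pd_comp₂ hψ hρ' hc',
    pd_sum fun i _ => (hvi i).fun_pow 2]
  simp only [pd_sq (hvi _), ← Finset.mul_sum, Model.dcψ₀]
  ring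

theorem contDiffAt_flux (hM : M.Regular) (hρ : SmoothAt 2 ρ t x) (hpos : 0 < ρ t x)
    (hv : SmoothAt 2 v t x) (hc : SmoothAt 2 c t x) (hμ : SmoothAt 2 μ t x) :
    ContDiffAt ℝ 1 (flux M ρ v c μ t) x := by
  have h12 : (1 : WithTop ℕ∞) ≤ 2 := one_le_two
  have hc1 := (hc.of_le h12).slice
  have hb : ContDiffAt ℝ 1 (fun y => M.b (c t y)) x := hM.b.contDiffAt.comp x hc1
  have hp : ContDiffAt ℝ 1 (fun y => M.p (ρ t y) (c t y)) x :=
    (smoothAt_comp₂ (hM.contDiffAt_p hpos) (hρ.of_le h12) (hc.of_le h12)).slice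
  have he := (smoothAt_massEnergy hM (hρ.of_le h12) hpos (hv.of_le h12) (hc.of_le h12)).slice
  exact ((((hμ.of_le h12).slice.smul (hb.smul (contDiffAt_gradient hμ.slice))).add
    ((contDiffAt_const.mul hc.deriv.slice).smul (contDiffAt_gradient hc.slice))).add
    (contDiffAt_stressWork hM hv.slice hc1)).sub
    ((((hρ.of_le h12).slice.mul he).smul (hv.of_le h12).slice).add
      (hp.smul (hv.of_le h12).slice))

/-- Mass conservation turns `ρ ∂ψ₀/∂ρ` times the material derivative of `ρ` into `-p div v`, which
joins `-v · ∇p` to form `-div(p v)`. The capillary power `-γ Δc (v · ∇c)` cancels the convective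
part of `γ Δc` times the material derivative of `c`; what remains, `γ Δc ∂ₜc`, combines with `γ ∇c ·
∂ₜ∇c` into the divergence of `γ ∂ₜc ∇c`. -/
theorem energy_identity (hM : M.Regular) (hs : IsSolution M U T ρ v c μ) (ht : t ∈ Ioo 0 T)
    (hx : x ∈ U.Ω) :
    deriv (fun s => energyDensity M (ρ s) (v s) (c s) x) t +
      dissipationDensity M (ρ t) (v t) (c t) (μ t) x - μ t x * M.F (ρ t x) (c t x) =
      dvg (flux M ρ v c μ t) x := by
  have h12 : (1 : WithTop ℕ∞) ≤ 2 := one_le_two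
  have htI := Ioo_subset_Icc_self ht
  have hxc := subset_closure hx
  have hpos := hs.ρ_pos t htI x hxc
  have hρ2 : SmoothAt 2 ρ t x := hs.reg_ρ t htI x hxc
  have hv2 : SmoothAt 2 v t x := hs.reg_v t htI x hxc
  have hc2 : SmoothAt 2 c t x := hs.reg_c t htI x hxc
  have hμ2 : SmoothAt 2 μ t x := hs.reg_μ t htI x hxc
  have hρ := hρ2.of_le h12
  have hv := hv2.of_le h12
  have hc := hc2.of_le h12
  have hμ := hμ2.of_le h12
  have mass := hs.mass t ht x hx
  have hE := smoothAt_massEnergy hM hρ hpos hv hc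
  have one : (1 : WithTop ℕ∞) ≠ 0 := one_ne_zero
  have dρ := hρ.slice.differentiableAt one
  have dv := hv.slice.differentiableAt one
  have dμ := hμ.slice.differentiableAt one
  have hbs : ContDiffAt ℝ 1 (fun y => M.b (c t y)) x := hM.b.contDiffAt.comp x hc.slice
  have hbμ : DifferentiableAt ℝ (fun y => M.b (c t y) • ∇ (μ t) y) x :=
    (hbs.smul (contDiffAt_gradient hμ2.slice)).differentiableAt one
  have hct : DifferentiableAt ℝ (fun y => M.γ * deriv (fun s => c s y) t) x :=
    (contDiffAt_const.mul hc2.deriv.slice).differentiableAt one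
  have hgc : DifferentiableAt ℝ (∇ (c t)) x :=
    (contDiffAt_gradient hc2.slice).differentiableAt one
  have hSv := (contDiffAt_stressWork hM hv2.slice hc.slice).differentiableAt one
  have hp : DifferentiableAt ℝ (fun y => M.p (ρ t y) (c t y)) x :=
    (smoothAt_comp₂ (hM.contDiffAt_p hpos) hρ hc).slice.differentiableAt one
  have hρE : DifferentiableAt ℝ (fun y => ρ t y * massEnergy M (ρ t) (v t) (c t) y) x :=
    (hρ.slice.mul hE.slice).differentiableAt one
  -- the divergence of the flux
  have hflux : dvg (flux M ρ v c μ t) x =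
      (μ t x * dvg (fun y => M.b (c t y) • ∇ (μ t) y) x +
          M.b (c t x) * ∑ i, pd i (μ t) x ^ 2
        + M.γ * (deriv (fun s => c s x) t * Δ (c t) x +
          ∑ i, pd i (c t) x * deriv (fun s => pd i (c s) x) t)
        + dvg (stressWork M (v t) (c t)) x)
      - (dvg (fun y => (ρ t y * massEnergy M (ρ t) (v t) (c t) y) • v t y) x
        + (M.p (ρ t x) (c t x) * dvg (v t) x
          + ∑ i, v t x i * pd i (fun y => M.p (ρ t y) (c t y)) x)) := by
    unfold flux
    rw [dvg_sub (((dμ.fun_smul hbμ).fun_add (hct.fun_smul hgc)).fun_add hSv)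
        ((hρE.fun_smul dv).fun_add (hp.fun_smul dv)),
      dvg_add ((dμ.fun_smul hbμ).fun_add (hct.fun_smul hgc)) hSv,
      dvg_add (dμ.fun_smul hbμ) (hct.fun_smul hgc), dvg_smul dμ hbμ, dvg_smul hct hgc,
      dvg_add (hρE.fun_smul dv) (hp.fun_smul dv), dvg_smul hp dv, dvg_gradient hc2.slice,
      clm_apply_eq_sum, clm_apply_eq_sum, clm_apply_eq_sum]
    have hA : ∑ i, (M.b (c t x) • ∇ (μ t) x) i *
        fderiv ℝ (μ t) x (EuclideanSpace.single i 1) = M.b (c t x) * ∑ i, pd i (μ t) x ^ 2 := by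
      rw [Finset.mul_sum]
      refine Finset.sum_congr rfl fun i _ => ?_
      simp only [PiLp.smul_apply, gradient_apply, smul_eq_mul, pd]
      ring
    have hB : ∑ i, (∇ (c t) x) i * fderiv ℝ (fun y => M.γ * deriv (fun s => c s y) t) x
        (EuclideanSpace.single i 1) =
        M.γ * ∑ i, pd i (c t) x * deriv (fun s => pd i (c s) x) t := by
      rw [Finset.mul_sum]
      refine Finset.sum_congr rfl fun i _ => ?_
      have := pd_const_mul M.γ (hc2.deriv.slice.differentiableAt one) i
      rw [gradient_apply, hc2.deriv_pd_comm i]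
      unfold pd at *
      rw [this]
      ring
    rw [hA, hB]
    simp only [pd]
    ring
  -- the time derivative of the energy density
  have hdt : deriv (fun s => energyDensity M (ρ s) (v s) (c s) x) t =
      deriv (fun s => ρ s x * massEnergy M (ρ s) (v s) (c s) x) t +
        M.γ * ∑ i, pd i (c t) x * deriv (fun s => pd i (c s) x) t := by
    have h1 : ∀ i, HasDerivAt (fun s => pd i (c s) x ^ 2)
        (2 * (pd i (c t) x * deriv (fun s => pd i (c s) x) t)) t := fun i => by
      have := (((hc2.pd i).time.differentiableAt one).hasDerivAt).fun_pow 2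
      exact this.congr_deriv (by push_cast; ring)
    have h2 : HasDerivAt (fun s => ρ s x * massEnergy M (ρ s) (v s) (c s) x) _ t :=
      ((hρ.time.mul hE.time).differentiableAt one).hasDerivAt
    have h3 := h2.add ((HasDerivAt.fun_sum (u := Finset.univ) fun i _ => h1 i).const_mul (M.γ / 2))
    have h4 := h3.deriv
    rw [← Finset.mul_sum] at h4
    simp only [energyDensity_eq]
    refine h4.trans ?_
    ring
  have htr := transport_eq hρ hE hv mass
  rw [deriv_massEnergy hM hρ hpos hv hc] at htr
  simp only [pd_massEnergy hM hρ.slice hpos hv.slice hc.slice] at htr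
  have hfrac := hs.fraction t ht x hx
  rw [transport_eq hρ hc hv mass] at hfrac
  have hmom : ∀ i, ρ t x * (deriv (fun s => v s x i) t +
      ∑ j, v t x j * pd j (fun y => v t y i) x) =
      -(pd i (fun y => M.p (ρ t y) (c t y)) x + M.γ * (pd i (c t) x * Δ (c t) x))
        + ∑ j, pd j (stress M (v t) (c t) i j) x - M.κ (ρ t x) (c t x) * v t x i := fun i => by
    have h := hs.momentum t ht x hx i
    rw [capillary_eq hc2.slice] at h
    rw [sum_pd_stress hM hv2.slice hc.slice, ← transport_eq hρ (hv.coord i) hv mass]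
    refine Eq.trans ?_ (h.trans (by ring))
    rfl
  have hpot := hs.potential t ht x hx
  have hmass : deriv (fun s => ρ s x) t + (ρ t x * dvg (v t) x + ∑ i, v t x i * pd i (ρ t) x) = 0 := by
    rw [dvg_smul dρ dv, clm_apply_eq_sum] at mass
    exact mass
  have hpdef : M.p (ρ t x) (c t x) = ρ t x ^ 2 * deriv (fun r => M.ψ₀ r (c t x)) (ρ t x) := rfl
  have hvm : ∑ i, v t x i * (ρ t x * (deriv (fun s => v s x i) t +
      ∑ j, v t x j * pd j (fun y => v t y i) x)) = ∑ i, v t x i *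
      (-(pd i (fun y => M.p (ρ t y) (c t y)) x + M.γ * (pd i (c t) x * Δ (c t) x))
        + ∑ j, pd j (stress M (v t) (c t) i j) x - M.κ (ρ t x) (c t x) * v t x i) :=
    Finset.sum_congr rfl fun i _ => by rw [hmom i]
  rw [hflux, hdt, dvg_stressWork hM hv2.slice hc.slice, dissipationDensity, norm_gradient_sq,
    norm_sq_eq_sum, hpdef]
  simp only [Fin.sum_univ_three] at *
  -- The transport identity for the energy per unit mass, plus each equation times its multiplier;
  -- `hvm` is the momentum equation already contracted with `v`.
  linear_combination htr + hvm + ρ t x * deriv (fun r => M.ψ₀ r (c t x)) (ρ t x) * hmass +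
    μ t x * hfrac - (deriv (fun s => c s x) t + (v t x 0 * pd 0 (c t) x + v t x 1 * pd 1 (c t) x +
      v t x 2 * pd 2 (c t) x)) * hpot

end Identity

/-! ### The integrated energy law -/

section EnergyLaw

open Filter Topology

variable {M : Model} {U : RegularDomain} {T : ℝ} {ρ : ℝ → E3 → ℝ} {v : ℝ → E3 → E3}
  {c μ : ℝ → E3 → ℝ} {t : ℝ} {x : E3}

/-- A function of time and space is continuous at every point of `[0,T] × closure Ω`. -/
def ContUpToBoundary (U : RegularDomain) (T : ℝ) (f : ℝ → E3 → ℝ) : Prop :=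
  ∀ t ∈ Icc 0 T, ∀ x ∈ closure U.Ω, ContinuousAt (fun z : ℝ × E3 => f z.1 z.2) (t, x)

theorem ContUpToBoundary.slice {f : ℝ → E3 → ℝ} (hf : ContUpToBoundary U T f)
    (ht : t ∈ Icc 0 T) (hx : x ∈ closure U.Ω) : ContinuousAt (f t) x :=
  ContinuousAt.comp (f := fun y : E3 => (t, y)) (g := fun z : ℝ × E3 => f z.1 z.2)
    (hf t ht x hx) (by fun_prop)

theorem ContUpToBoundary.integrableOn {f : ℝ → E3 → ℝ} (hf : ContUpToBoundary U T f)
    (ht : t ∈ Icc 0 T) : IntegrableOn (f t) U.Ω :=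
  U.integrableOn_of_continuousAt fun _ hx => hf.slice ht hx

theorem ContUpToBoundary.exists_bound {f : ℝ → E3 → ℝ} (hf : ContUpToBoundary U T f) :
    ∃ B, ∀ t ∈ Icc 0 T, ∀ x ∈ closure U.Ω, |f t x| ≤ B := by
  obtain ⟨B, hB⟩ := ((isCompact_Icc (a := (0 : ℝ)) (b := T)).prod
    U.isCompact_closure).exists_bound_of_continuousOn
    (f := fun z : ℝ × E3 => f z.1 z.2) fun z hz => (hf z.1 hz.1 z.2 hz.2).continuousWithinAt
  exact ⟨B, fun t ht x hx => hB (t, x) ⟨ht, hx⟩⟩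

theorem RegularDomain.integrableOn_const (U : RegularDomain) (B : ℝ) :
    IntegrableOn (fun _ => B) U.Ω :=
  U.integrableOn_of_continuousAt fun _ _ => continuousAt_const

theorem ContUpToBoundary.continuousOn_integral {f : ℝ → E3 → ℝ} (hf : ContUpToBoundary U T f) :
    ContinuousOn (fun t => ∫ x in U.Ω, f t x) (Icc 0 T) := by
  obtain ⟨B, hB⟩ := hf.exists_bound
  refine continuousOn_of_dominated (bound := fun _ => B)
    (fun t ht => (hf.integrableOn ht).aestronglyMeasurable) (fun t ht => ?_)
    (U.integrableOn_const B) ?_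
  · exact (ae_restrict_iff' U.isOpen.measurableSet).2
      (ae_of_all _ fun x hx => hB t ht x (subset_closure hx))
  · refine (ae_restrict_iff' U.isOpen.measurableSet).2 (ae_of_all _ fun x hx t ht => ?_)
    exact (ContinuousAt.comp (f := fun s : ℝ => (s, x)) (g := fun z : ℝ × E3 => f z.1 z.2)
      (hf t ht x (subset_closure hx)) (by fun_prop)).continuousWithinAt

theorem contUpToBoundary_deriv {f : ℝ → E3 → ℝ}
    (hf : ∀ t ∈ Icc 0 T, ∀ x ∈ closure U.Ω, SmoothAt 1 f t x) :
    ContUpToBoundary U T fun t x => deriv (fun s => f s x) t := by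
  intro t ht x hx
  have h1 := (hf t ht x hx).eventually (by simp)
  have h2 : ContinuousAt (fun z => fderiv ℝ (fun z : ℝ × E3 => f z.1 z.2) z (1, 0)) (t, x) :=
    (ContDiffAt.continuousAt_fderiv (hf t ht x hx) one_ne_zero).clm_apply continuousAt_const
  exact h2.congr (h1.mono fun z hz => (SmoothAt.hasDerivAt hz).deriv.symm)

/-- Differentiation under the integral sign. -/
theorem hasDerivAt_integral {f : ℝ → E3 → ℝ}
    (hf : ∀ t ∈ Icc 0 T, ∀ x ∈ closure U.Ω, SmoothAt 1 f t x) (ht : t ∈ Ioo 0 T) :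
    HasDerivAt (fun s => ∫ x in U.Ω, f s x) (∫ x in U.Ω, deriv (fun s => f s x) t) t := by
  have hc : ContUpToBoundary U T f := fun t ht x hx => (hf t ht x hx).continuousAt
  have hd := contUpToBoundary_deriv hf
  obtain ⟨B, hB⟩ := hd.exists_bound
  have htI := Ioo_subset_Icc_self ht
  have hnhds : Ioo 0 T ∈ 𝓝 t := isOpen_Ioo.mem_nhds ht
  refine (hasDerivAt_integral_of_dominated_loc_of_deriv_le (bound := fun _ => B)
    (F' := fun s x => deriv (fun s => f s x) s) hnhds ?_ (hc.integrableOn htI)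
    (hd.integrableOn htI).aestronglyMeasurable ?_ (U.integrableOn_const B) ?_).2
  · filter_upwards [hnhds] with s hs
    exact (hc.integrableOn (Ioo_subset_Icc_self hs)).aestronglyMeasurable
  · exact (ae_restrict_iff' U.isOpen.measurableSet).2
      (ae_of_all _ fun x hx s hs => hB s (Ioo_subset_Icc_self hs) x (subset_closure hx))
  · exact (ae_restrict_iff' U.isOpen.measurableSet).2 (ae_of_all _ fun x hx s hs =>
      ((hf s (Ioo_subset_Icc_self hs) x (subset_closure hx)).time.differentiableAt
        one_ne_zero).hasDerivAt)

theorem contUpToBoundary_comp₂ {Ψ : ℝ → ℝ → ℝ} {f g : ℝ → E3 → ℝ}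
    (h : ∀ t ∈ Icc 0 T, ∀ x ∈ closure U.Ω,
      ContinuousAt (fun z : ℝ × ℝ => Ψ z.1 z.2) (f t x, g t x))
    (hf : ContUpToBoundary U T f) (hg : ContUpToBoundary U T g) :
    ContUpToBoundary U T fun t x => Ψ (f t x) (g t x) := fun t ht x hx =>
  ContinuousAt.comp (f := fun z : ℝ × E3 => (f z.1 z.2, g z.1 z.2))
    (g := fun z : ℝ × ℝ => Ψ z.1 z.2) (h t ht x hx) ((hf t ht x hx).prodMk (hg t ht x hx))

theorem contUpToBoundary_dissipationDensity (hM : M.Regular) (hs : IsSolution M U T ρ v c μ) :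
    ContUpToBoundary U T fun t => dissipationDensity M (ρ t) (v t) (c t) (μ t) := by
  intro t ht x hx
  have hρ : SmoothAt 2 ρ t x := hs.reg_ρ t ht x hx
  have hv : SmoothAt 2 v t x := hs.reg_v t ht x hx
  have hc : SmoothAt 2 c t x := hs.reg_c t ht x hx
  have hμ : SmoothAt 2 μ t x := hs.reg_μ t ht x hx
  have hν : ContinuousAt (fun z : ℝ × E3 => M.ν (c z.1 z.2)) (t, x) :=
    hM.ν.continuous.continuousAt.comp hc.continuousAt
  have hb : ContinuousAt (fun z : ℝ × E3 => M.b (c z.1 z.2)) (t, x) :=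
    hM.b.continuous.continuousAt.comp hc.continuousAt
  have hκ : ContinuousAt (fun z : ℝ × E3 => M.κ (ρ z.1 z.2) (c z.1 z.2)) (t, x) :=
    ContinuousAt.comp (f := fun z : ℝ × E3 => (ρ z.1 z.2, c z.1 z.2))
      (g := fun z : ℝ × ℝ => M.κ z.1 z.2) (hM.continuousAt_κ (hs.ρ_pos t ht x hx))
      (hρ.continuousAt.prodMk hc.continuousAt)
  have hpd : ∀ i j, ContinuousAt (fun z : ℝ × E3 => pd j (fun y => v z.1 y i) z.2) (t, x) :=
    fun i j => ((hv.coord i).pd j).continuousAt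
  have hdiv : ContinuousAt (fun z : ℝ × E3 => dvg (v z.1) z.2) (t, x) :=
    tendsto_finsetSum _ fun i _ => hpd i i
  have hdev : ContinuousAt (fun z : ℝ × E3 => deviatoricSq (v z.1) z.2) (t, x) := by
    refine tendsto_finsetSum _ fun i _ => tendsto_finsetSum _ fun j _ => ?_
    refine (((hpd i j).add (hpd j i)).sub ?_).pow 2
    split_ifs
    · exact continuousAt_const.mul hdiv
    · exact continuousAt_const
  have hgμ : ContinuousAt (fun z : ℝ × E3 => ‖∇ (μ z.1) z.2‖ ^ 2) (t, x) := by
    simp only [norm_gradient_sq]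
    exact tendsto_finsetSum _ fun i _ => (hμ.pd i).continuousAt.pow 2
  exact (((hν.div_const 2).mul hdev).add (hb.mul hgμ)).add (hκ.mul (hv.continuousAt.norm.pow 2))

theorem smoothAt_energyDensity_of_isSolution (hM : M.Regular) (hs : IsSolution M U T ρ v c μ) :
    ∀ t ∈ Icc 0 T, ∀ x ∈ closure U.Ω,
      SmoothAt 1 (fun s y => energyDensity M (ρ s) (v s) (c s) y) t x := fun t ht x hx =>
  smoothAt_energyDensity hM (hs.reg_ρ t ht x hx) (hs.ρ_pos t ht x hx) (hs.reg_v t ht x hx)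
    (hs.reg_c t ht x hx)

theorem RegularDomain.fderiv_phi_gradient (U : RegularDomain) (hx : U.φ x = 0) (f : E3 → ℝ) :
    fderiv ℝ U.φ x (∇ f x) = ‖∇ U.φ x‖ * U.normalDeriv f x := by
  have hn : ‖∇ U.φ x‖ ≠ 0 := norm_ne_zero_iff.2 (U.gradient_ne_zero x hx)
  rw [normalDeriv, normal, inner_smul_right, mul_inv_cancel_left₀ hn, real_inner_comm,
    inner_gradient_left]

/-- No slip removes the convective, pressure and viscous fluxes; the Neumann conditions remove the
normal part of the other two. The condition on `μ` enters only as the product with `b`, so no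
positivity of the mobility is required. -/
theorem fderiv_phi_flux (hs : IsSolution M U T ρ v c μ) (ht : t ∈ Ioo 0 T)
    (hx : x ∈ frontier U.Ω) : fderiv ℝ U.φ x (flux M ρ v c μ t x) = 0 := by
  have hφ := U.phi_eq_zero_of_mem_frontier hx
  have hv := hs.bc_v t ht x hx
  have hS : stressWork M (v t) (c t) x = 0 := by
    ext i
    simp [stressWork, hv]
  rw [flux, hv, hS]
  simp only [smul_zero, add_zero, sub_zero, map_add, map_smul, smul_eq_mul,
    U.fderiv_phi_gradient hφ, hs.bc_c t ht x hx, mul_zero]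
  linear_combination μ t x * ‖∇ U.φ x‖ * hs.bc_μ t ht x hx

/-- No regularity of `F` is assumed. Integrability comes from the mass-fraction equation, which
equates the source with an expression continuous up to the boundary. -/
theorem integrableOn_source (hM : M.Regular) (hs : IsSolution M U T ρ v c μ) (ht : t ∈ Ioo 0 T) :
    IntegrableOn (fun x => M.F (ρ t x) (c t x)) U.Ω := by
  have h12 : (1 : WithTop ℕ∞) ≤ 2 := one_le_two
  have htI := Ioo_subset_Icc_self ht
  have h : IntegrableOn (fun x => deriv (fun s => ρ s x * c s x) t +
      dvg (fun y => (ρ t y * c t y) • v t y) x - dvg (fun y => M.b (c t y) • ∇ (μ t) y) x) U.Ω := by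
    refine U.integrableOn_of_continuousAt fun x hx => ?_
    have hρ : SmoothAt 1 ρ t x := (hs.reg_ρ t htI x hx).of_le h12
    have hv : SmoothAt 1 v t x := (hs.reg_v t htI x hx).of_le h12
    have hc : SmoothAt 1 c t x := (hs.reg_c t htI x hx).of_le h12
    have hμ : SmoothAt 2 μ t x := hs.reg_μ t htI x hx
    have hb : ContDiffAt ℝ 1 (fun y => M.b (c t y)) x := hM.b.contDiffAt.comp x hc.slice
    refine (ContinuousAt.add ?_ (continuousAt_dvg ((hρ.slice.mul hc.slice).smul hv.slice))).sub
      (continuousAt_dvg (hb.smul (contDiffAt_gradient hμ.slice)))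
    refine ContUpToBoundary.slice (T := T) (contUpToBoundary_deriv
      (f := fun s y => ρ s y * c s y) fun t ht x hx => ?_) htI hx
    exact ContDiffAt.mul (ContDiffAt.of_le (hs.reg_ρ t ht x hx) h12)
      (ContDiffAt.of_le (hs.reg_c t ht x hx) h12)
  refine h.congr_fun (fun x hx => ?_) U.isOpen.measurableSet
  simp only
  rw [hs.fraction t ht x hx]
  ring

theorem RegularDomain.integrableOn_mul (U : RegularDomain) {f g : E3 → ℝ} (hg : IntegrableOn g U.Ω)
    (hf : ∀ x ∈ closure U.Ω, ContinuousAt f x) : IntegrableOn (fun x => f x * g x) U.Ω := by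
  obtain ⟨B, hB⟩ := U.isCompact_closure.exists_bound_of_continuousOn
    (f := f) fun x hx => (hf x hx).continuousWithinAt
  exact Integrable.bdd_mul hg (U.integrableOn_of_continuousAt hf).aestronglyMeasurable
    ((ae_restrict_iff' U.isOpen.measurableSet).2 (ae_of_all _ fun x hx => hB x (subset_closure hx)))

theorem integrableOn_mul_source (hM : M.Regular) (hs : IsSolution M U T ρ v c μ)
    (ht : t ∈ Ioo 0 T) : IntegrableOn (fun x => μ t x * M.F (ρ t x) (c t x)) U.Ω :=
  U.integrableOn_mul (integrableOn_source hM hs ht) fun _ hx =>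
    ContUpToBoundary.slice (T := T) (fun t ht x hx => (hs.reg_μ t ht x hx).continuousAt)
      (Ioo_subset_Icc_self ht) hx

theorem hasDerivAt_energy (hM : M.Regular) (hs : IsSolution M U T ρ v c μ) (ht : t ∈ Ioo 0 T) :
    HasDerivAt (energy M U ρ v c)
      ((∫ x in U.Ω, μ t x * M.F (ρ t x) (c t x)) - dissipation M U ρ v c μ t) t := by
  have htI := Ioo_subset_Icc_self ht
  have hsm := smoothAt_energyDensity_of_isSolution hM hs
  have h := hasDerivAt_integral hsm ht
  have hdiv : ∫ x in U.Ω, dvg (flux M ρ v c μ t) x = 0 :=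
    U.integral_dvg_eq_zero (fun x hx => contDiffAt_flux hM (hs.reg_ρ t htI x hx)
      (hs.ρ_pos t htI x hx) (hs.reg_v t htI x hx) (hs.reg_c t htI x hx) (hs.reg_μ t htI x hx))
      fun x hx => fderiv_phi_flux hs ht hx
  have hi1 := (contUpToBoundary_deriv hsm).integrableOn htI
  have hi2 := (contUpToBoundary_dissipationDensity hM hs).integrableOn htI
  have hi3 := integrableOn_mul_source hM hs ht
  have e : ∫ x in U.Ω, dvg (flux M ρ v c μ t) x =
      (∫ x in U.Ω, deriv (fun s => energyDensity M (ρ s) (v s) (c s) x) t) +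
        dissipation M U ρ v c μ t - ∫ x in U.Ω, μ t x * M.F (ρ t x) (c t x) := by
    have hi12 : Integrable (fun x => deriv (fun s => energyDensity M (ρ s) (v s) (c s) x) t +
        dissipationDensity M (ρ t) (v t) (c t) (μ t) x) (volume.restrict U.Ω) := hi1.add hi2
    rw [dissipation, ← integral_add hi1 hi2, ← integral_sub hi12 hi3]
    exact setIntegral_congr_fun U.isOpen.measurableSet fun x hx =>
      (energy_identity hM hs ht hx).symm
  rw [hdiv] at e
  exact h.congr_deriv (by linarith)

end EnergyLaw

/-! ### Absorption of the source term -/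

section Estimate

open Filter Topology

variable {M : Model} {U : RegularDomain} {T : ℝ} {ρ : ℝ → E3 → ℝ} {v : ℝ → E3 → E3}
  {c μ : ℝ → E3 → ℝ} {t : ℝ} {x : E3}

theorem enorm_sq_eq_ofReal {F : Type*} [NormedAddCommGroup F] (y : F) :
    ‖y‖ₑ ^ 2 = ENNReal.ofReal (‖y‖ ^ 2) := by
  rw [← ofReal_norm, ENNReal.ofReal_pow (norm_nonneg _)]

theorem RegularDomain.poincare_integral (U : RegularDomain) :
    ∃ C : ℝ, 0 < C ∧ ∀ u : E3 → ℝ, (∀ x ∈ closure U.Ω, ContDiffAt ℝ 1 u x) →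
      ∃ m : ℝ, ∫ x in U.Ω, (u x - m) ^ 2 ≤ C * ∫ x in U.Ω, ‖∇ u x‖ ^ 2 := by
  obtain ⟨C, hC⟩ := U.poincare
  -- The shift makes the constant strictly positive, since it is divided by later.
  refine ⟨C + 1, by positivity, fun u hu => ?_⟩
  obtain ⟨m, hm⟩ := hC u fun x hx => (hu x (subset_closure hx)).contDiffWithinAt
  refine ⟨m, ?_⟩
  have hi1 : IntegrableOn (fun x => (u x - m) ^ 2) U.Ω :=
    U.integrableOn_of_continuousAt fun x hx => ((hu x hx).continuousAt.sub continuousAt_const).pow 2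
  have hi2 : IntegrableOn (fun x => ‖∇ u x‖ ^ 2) U.Ω := by
    simp only [norm_gradient]
    exact U.integrableOn_of_continuousAt fun x hx =>
      ((hu x hx).continuousAt_fderiv one_ne_zero).norm.pow 2
  have h0 : 0 ≤ ∫ x in U.Ω, ‖∇ u x‖ ^ 2 := integral_nonneg fun _ => by positivity
  simp only [enorm_sq_eq_ofReal, Real.norm_eq_abs, sq_abs, ← norm_gradient] at hm
  rw [← ofReal_integral_eq_lintegral_ofReal hi1 (ae_of_all _ fun _ => sq_nonneg _),
    ← ofReal_integral_eq_lintegral_ofReal hi2 (ae_of_all _ fun _ => sq_nonneg _),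
    ← ENNReal.ofReal_coe_nnreal, ← ENNReal.ofReal_mul C.coe_nonneg,
    ENNReal.ofReal_le_ofReal_iff (mul_nonneg C.coe_nonneg h0)] at hm
  exact hm.trans (by gcongr; linarith)

theorem abs_mul_log_le {r : ℝ} (hr : 0 < r) : |r * Real.log r| ≤ 1 + r ^ 2 := by
  have h1 := Real.log_le_sub_one_of_pos hr
  have h2 := Real.one_sub_inv_le_log_of_pos hr
  have h3 : r * (1 - r⁻¹) = r - 1 := by field_simp
  rw [abs_le]
  constructor <;> nlinarith [mul_le_mul_of_nonneg_left h1 hr.le, mul_le_mul_of_nonneg_left h2 hr.le]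

/-- As `a > 2`, the factor `r ^ (a - 2)` reaches `N` at the threshold `R`; below it the left-hand
side is at most a constant. -/
theorem exists_sq_le_rpow {a : ℝ} (ha : 2 < a) {N : ℝ} (hN : 0 ≤ N) :
    ∃ C, 0 ≤ C ∧ ∀ r : ℝ, 0 < r → N * r ^ 2 ≤ C + r ^ a := by
  set R := N ^ (a - 2)⁻¹ with hR
  have ha2 : 0 < a - 2 := by linarith
  have hR0 : 0 ≤ R := Real.rpow_nonneg hN _
  have hRN : R ^ (a - 2) = N := Real.rpow_inv_rpow hN ha2.ne'
  refine ⟨N * R ^ 2, by positivity, fun r hr => ?_⟩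
  have hra : r ^ a = r ^ (a - 2) * r ^ 2 := by
    rw [← Real.rpow_natCast r 2, ← Real.rpow_add hr]
    norm_num
  have hra0 : 0 ≤ r ^ a := Real.rpow_nonneg hr.le _
  rcases le_total r R with h | h
  · have : N * r ^ 2 ≤ N * R ^ 2 := by gcongr
    linarith
  · have h1 : N ≤ r ^ (a - 2) := hRN ▸ Real.rpow_le_rpow hR0 h ha2.le
    have : N * r ^ 2 ≤ r ^ a := by rw [hra]; gcongr
    have : 0 ≤ N * R ^ 2 := by positivity
    linarith

namespace Model

/-- The derivative of the quartic well is unbounded, but a cubic is dominated by a quartic;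
comparison with `Q` itself also covers the truncated case. -/
theorem Admissible.exists_abs_deriv_Q_le {a : ℝ} (h : M.Admissible a) :
    ∃ k, 0 ≤ k ∧ ∀ s, |deriv M.Q s| ≤ k + 2 * M.Q s := by
  rcases h.Q_spec with hQ | ⟨K, hK⟩
  · refine ⟨5 / 4, by norm_num, fun s => ?_⟩
    have hQ' : M.Q = fun s => s ^ 2 * (1 - s) ^ 2 / 4 := funext hQ
    have hd : HasDerivAt M.Q (s * (1 - s) * (1 - 2 * s) / 2) s := by
      rw [hQ']
      have := ((((hasDerivAt_id s).fun_pow 2).mul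
        (((hasDerivAt_id s).const_sub 1).fun_pow 2)).div_const 4)
      refine this.congr_deriv ?_
      simp
      ring
    rw [hd.deriv, hQ, abs_le]
    -- With `w = s (1 - s)` one has `Q = w² / 4` and `(1 - 2 s)² = 1 - 4 w`. Young's inequality and
    -- `-4 w ≤ w² + 4` give `|Q'| ≤ 5 / 4 + w² / 2`.
    constructor <;>
      nlinarith [sq_nonneg (s * (1 - s) + (1 - 2 * s)), sq_nonneg (s * (1 - s) - (1 - 2 * s)),
        sq_nonneg (s * (1 - s) + 2), sq_nonneg (s * (1 - s))]
  · have hK0 : 0 ≤ K := (abs_nonneg _).trans (hK 0).1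
    refine ⟨3 * K, by positivity, fun s => ?_⟩
    have := (abs_le.1 (hK s).1).1
    linarith [(hK s).2]

/-- The logarithmic terms grow at most like `r ^ 2`, which `r ^ a` dominates, while the term `2 r Q`
from `|Q'|` is matched by `2 r ψ₀`; hence `B = 2`. -/
theorem Admissible.exists_sq_add_le (hM : M.Regular) {a : ℝ} (h : M.Admissible a) :
    ∃ A B, 0 < A ∧ 0 < B ∧ ∀ r s, 0 < r →
      r ^ 2 + r * |M.dcψ₀ r s| ≤ A + B * (r * M.ψ₀ r s) := by
  obtain ⟨K, hK⟩ := h.H_bdd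
  obtain ⟨k, hk0, hk⟩ := h.exists_abs_deriv_Q_le
  have hK0 : 0 ≤ K := (abs_nonneg _).trans (hK 0).1
  have ha1 : 0 < a - 1 := by linarith [h.two_lt]
  -- The coefficient of `r ^ 2` to absorb: `1` from the square itself, `K` from `H'`, `2 * K` from
  -- `H` inside `2 r ψ₀`, and `k` from `k r ≤ k (1 + r ^ 2)`.
  set N := 1 + 3 * K + k with hN
  obtain ⟨C, hC0, hC⟩ := exists_sq_le_rpow h.two_lt (N := N * (a - 1) / 2) (by positivity)
  refine ⟨N + 2 * C / (a - 1), 2, by positivity, two_pos, fun r s hr => ?_⟩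
  have hψe : r * M.ψe r = r ^ a / (a - 1) := by
    rw [h.ψe_eq r hr, mul_div_assoc', mul_comm r, Real.rpow_sub_one hr.ne',
      div_mul_cancel₀ _ hr.ne']
  have hlog := abs_mul_log_le hr
  have hH : |M.H s * (r * Real.log r)| ≤ K * (1 + r ^ 2) := by
    rw [abs_mul]
    exact mul_le_mul (hK s).1 hlog (abs_nonneg _) hK0
  have hH' : |deriv M.H s * (r * Real.log r)| ≤ K * (1 + r ^ 2) := by
    rw [abs_mul]
    exact mul_le_mul (hK s).2 hlog (abs_nonneg _) hK0
  have hdc : r * |M.dcψ₀ r s| ≤ K * (1 + r ^ 2) + r * (k + 2 * M.Q s) := by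
    calc r * |M.dcψ₀ r s| = |deriv M.H s * (r * Real.log r) + r * deriv M.Q s| := by
          rw [hM.dcψ₀_eq, ← abs_of_pos hr, ← abs_mul, abs_of_pos hr]
          congr 1
          ring
      _ ≤ |deriv M.H s * (r * Real.log r)| + |r * deriv M.Q s| := abs_add_le _ _
      _ ≤ _ := by
          rw [abs_mul r, abs_of_pos hr]
          gcongr
          exact hk s
  have hψ : r * M.ψ₀ r s = r ^ a / (a - 1) + M.H s * (r * Real.log r) + r * M.Q s := by
    rw [ψ₀, ← hψe]
    ring
  have hNr : N * r ^ 2 ≤ 2 * C / (a - 1) + 2 * (r ^ a / (a - 1)) := by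
    have := mul_le_mul_of_nonneg_left (hC r hr) (by positivity : 0 ≤ 2 / (a - 1))
    have e : 2 / (a - 1) * (N * (a - 1) / 2 * r ^ 2) = N * r ^ 2 := by field_simp
    rw [e] at this
    refine this.trans (le_of_eq ?_)
    ring
  have hr2 : k * r ≤ k * (1 + r ^ 2) := by
    gcongr
    nlinarith [sq_nonneg (r - 1)]
  rw [hψ]
  have := (abs_le.1 hH).1
  rw [hN] at *
  nlinarith

theorem Admissible.exists_abs_F_le {a : ℝ} (h : M.Admissible a) :
    ∃ K, 0 ≤ K ∧ ∀ r s, 0 < r → |M.F r s| ≤ K * r := by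
  obtain ⟨K, hK⟩ := h.F_bdd
  refine ⟨K, le_trans (by positivity) (hK 1 0 one_pos), fun r s hr => ?_⟩
  have h1 : |M.F r s / r| ≤ K := le_trans (by linarith [abs_nonneg (M.F r s)]) (hK r s hr)
  rwa [abs_div, abs_of_pos hr, div_le_iff₀ hr] at h1

end Model

theorem IsSolution.contUpToBoundary_ρ (hs : IsSolution M U T ρ v c μ) : ContUpToBoundary U T ρ :=
  fun t ht x hx => (hs.reg_ρ t ht x hx).continuousAt

theorem IsSolution.contUpToBoundary_c (hs : IsSolution M U T ρ v c μ) : ContUpToBoundary U T c :=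
  fun t ht x hx => (hs.reg_c t ht x hx).continuousAt

theorem IsSolution.contUpToBoundary_μ (hs : IsSolution M U T ρ v c μ) : ContUpToBoundary U T μ :=
  fun t ht x hx => (hs.reg_μ t ht x hx).continuousAt

theorem Model.Regular.continuousAt_dcψ₀ (hM : M.Regular) {r s : ℝ} (hr : 0 < r) :
    ContinuousAt (fun z : ℝ × ℝ => M.dcψ₀ z.1 z.2) (r, s) := by
  simp only [hM.dcψ₀_eq]
  have h1 : Continuous fun z : ℝ × ℝ => deriv M.H z.2 :=
    (hM.H.continuous_deriv le_rfl).comp continuous_snd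
  have h2 : Continuous fun z : ℝ × ℝ => deriv M.Q z.2 :=
    (hM.Q.continuous_deriv le_rfl).comp continuous_snd
  exact (h1.continuousAt.mul (continuousAt_fst.log hr.ne')).add h2.continuousAt

theorem IsSolution.contUpToBoundary_dcψ₀ (hM : M.Regular) (hs : IsSolution M U T ρ v c μ) :
    ContUpToBoundary U T fun t x => M.dcψ₀ (ρ t x) (c t x) :=
  contUpToBoundary_comp₂ (fun t ht x hx => hM.continuousAt_dcψ₀ (hs.ρ_pos t ht x hx))
    hs.contUpToBoundary_ρ hs.contUpToBoundary_c

theorem IsSolution.contUpToBoundary_energyDensity (hM : M.Regular)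
    (hs : IsSolution M U T ρ v c μ) :
    ContUpToBoundary U T fun t x => energyDensity M (ρ t) (v t) (c t) x := fun t ht x hx =>
  (smoothAt_energyDensity_of_isSolution hM hs t ht x hx).continuousAt

/-- The Neumann condition makes `∇c` tangential, so `Δc` integrates to zero. This is the only
control on the size of `μ`, as opposed to its gradient. -/
theorem integral_density_mul_potential (hM : M.Regular) (hs : IsSolution M U T ρ v c μ)
    (ht : t ∈ Ioo 0 T) :
    ∫ x in U.Ω, ρ t x * μ t x = ∫ x in U.Ω, ρ t x * M.dcψ₀ (ρ t x) (c t x) := by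
  have htI := Ioo_subset_Icc_self ht
  have hgrad : ∀ x ∈ closure U.Ω, ContDiffAt ℝ 1 (∇ (c t)) x := fun x hx =>
    contDiffAt_gradient (SmoothAt.slice (hs.reg_c t htI x hx))
  have h0 : ∫ x in U.Ω, dvg (∇ (c t)) x = 0 :=
    U.integral_dvg_eq_zero hgrad fun x hx => by
      rw [U.fderiv_phi_gradient (U.phi_eq_zero_of_mem_frontier hx), hs.bc_c t ht x hx, mul_zero]
  have hi1 : IntegrableOn (fun x => -M.γ * dvg (∇ (c t)) x) U.Ω :=
    U.integrableOn_of_continuousAt fun x hx => continuousAt_const.mul (continuousAt_dvg (hgrad x hx))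
  have hi2 : IntegrableOn (fun x => ρ t x * M.dcψ₀ (ρ t x) (c t x)) U.Ω :=
    U.integrableOn_of_continuousAt fun x hx => (hs.contUpToBoundary_ρ.slice htI hx).mul
      ((hs.contUpToBoundary_dcψ₀ hM).slice htI hx)
  calc ∫ x in U.Ω, ρ t x * μ t x
      = ∫ x in U.Ω, (-M.γ * dvg (∇ (c t)) x + ρ t x * M.dcψ₀ (ρ t x) (c t x)) := by
        refine setIntegral_congr_fun U.isOpen.measurableSet fun x hx => ?_
        rw [hs.potential t ht x hx,
          dvg_gradient (SmoothAt.slice (hs.reg_c t htI x (subset_closure hx)))]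
    _ = _ := by rw [integral_add hi1 hi2, integral_const_mul, h0, mul_zero, zero_add]

theorem dissipationDensity_ge {a : ℝ} (h : M.Admissible a) {b₀ : ℝ} (hb : ∀ s, b₀ ≤ M.b s)
    {ρ : E3 → ℝ} (v : E3 → E3) (c μ : E3 → ℝ) (hρ : 0 < ρ x) :
    b₀ * ‖∇ μ x‖ ^ 2 ≤ dissipationDensity M ρ v c μ x := by
  obtain ⟨ν₀, hν₀, hν⟩ := h.ν_lower
  have h1 : 0 ≤ M.ν (c x) / 2 * deviatoricSq v x :=
    mul_nonneg (by linarith [hν (c x)])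
      (Finset.sum_nonneg fun _ _ => Finset.sum_nonneg fun _ _ => sq_nonneg _)
  have h2 : 0 ≤ M.κ (ρ x) (c x) * ‖v x‖ ^ 2 := mul_nonneg (h.κ_nonneg _ _ hρ) (sq_nonneg _)
  have h3 : b₀ * ‖∇ μ x‖ ^ 2 ≤ M.b (c x) * ‖∇ μ x‖ ^ 2 := by
    gcongr
    exact hb _
  rw [dissipationDensity]
  linarith

theorem le_energyDensity {a : ℝ} (h : M.Admissible a) {ρ : E3 → ℝ} (v : E3 → E3) (c : E3 → ℝ)
    (hρ : 0 < ρ x) : ρ x * M.ψ₀ (ρ x) (c x) ≤ energyDensity M ρ v c x := by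
  have h1 : 0 ≤ ρ x * (‖v x‖ ^ 2 / 2) := by positivity
  have h2 : 0 ≤ M.γ / 2 * ‖∇ c x‖ ^ 2 := mul_nonneg (by linarith [h.γ_pos]) (sq_nonneg _)
  rw [energyDensity]
  linarith

theorem setIntegral_le_of_le (U : RegularDomain) {f g : E3 → ℝ} (hf : IntegrableOn f U.Ω)
    (hg : IntegrableOn g U.Ω) (h : ∀ x ∈ U.Ω, f x ≤ g x) :
    ∫ x in U.Ω, f x ≤ ∫ x in U.Ω, g x :=
  setIntegral_mono_on hf hg U.isOpen.measurableSet h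

theorem dissipation_nonneg {a : ℝ} (h : M.Admissible a) (hs : IsSolution M U T ρ v c μ)
    (ht : t ∈ Icc 0 T) : 0 ≤ dissipation M U ρ v c μ t := by
  obtain ⟨b₀, hb₀, hb⟩ := h.b_lower
  refine setIntegral_nonneg U.isOpen.measurableSet fun x hx => ?_
  exact le_trans (by positivity)
    (dissipationDensity_ge h hb (v t) (c t) (μ t) (hs.ρ_pos t ht x (subset_closure hx)))

/-- The power of the source term is absorbed by half of the dissipation, up to a multiple of the
energy. -/
theorem integral_mul_source_le (hM : M.Regular) {a : ℝ} (h : M.Admissible a) (U : RegularDomain)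
    {A B : ℝ} (hB : 0 < B) (hAB : ∀ r s, 0 < r →
      r ^ 2 + r * |M.dcψ₀ r s| ≤ A + B * (r * M.ψ₀ r s)) :
    ∃ L, 0 ≤ L ∧ ∀ (T : ℝ) (ρ : ℝ → E3 → ℝ) (v : ℝ → E3 → E3) (c μ : ℝ → E3 → ℝ),
      IsSolution M U T ρ v c μ → ∀ t ∈ Ioo 0 T,
        ∫ x in U.Ω, μ t x * M.F (ρ t x) (c t x) ≤ dissipation M U ρ v c μ t / 2 +
          L * ∫ x in U.Ω, (A + B * energyDensity M (ρ t) (v t) (c t) x) := by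
  obtain ⟨b₀, hb₀, hb⟩ := h.b_lower
  obtain ⟨K, hK0, hK⟩ := h.exists_abs_F_le
  obtain ⟨C, hC0, hC⟩ := U.poincare_integral
  -- Chosen so that `δ * C = b₀ / 2`: after Poincaré, the Young term costs half of the dissipation.
  set δ := b₀ / (2 * C) with hδ
  have hδ0 : 0 < δ := by positivity
  refine ⟨K ^ 2 / δ + K, by positivity, fun T ρ v c μ hs t ht => ?_⟩
  have htI := Ioo_subset_Icc_self ht
  obtain ⟨m, hm⟩ := hC (μ t) fun x hx =>
    (SmoothAt.slice (hs.reg_μ t htI x hx)).of_le one_le_two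
  have hρc : ∀ x ∈ closure U.Ω, ContinuousAt (ρ t) x := fun x hx =>
    hs.contUpToBoundary_ρ.slice htI hx
  have hwc : ∀ x ∈ closure U.Ω, ContinuousAt (fun x => μ t x - m) x := fun x hx =>
    (hs.contUpToBoundary_μ.slice htI hx).sub continuousAt_const
  have hdc : ∀ x ∈ closure U.Ω, ContinuousAt (fun x => M.dcψ₀ (ρ t x) (c t x)) x := fun x hx =>
    (hs.contUpToBoundary_dcψ₀ hM).slice htI hx
  have hρpos : ∀ x ∈ U.Ω, 0 < ρ t x := fun x hx => hs.ρ_pos t htI x (subset_closure hx)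
  have iρ := U.integrableOn_of_continuousAt hρc
  have iF := integrableOn_source hM hs ht
  have iwF : IntegrableOn (fun x => (μ t x - m) * M.F (ρ t x) (c t x)) U.Ω :=
    U.integrableOn_mul iF hwc
  have iρw : IntegrableOn (fun x => ρ t x * |μ t x - m|) U.Ω :=
    U.integrableOn_of_continuousAt fun x hx => (hρc x hx).mul (hwc x hx).abs
  have iρw' : IntegrableOn (fun x => ρ t x * (μ t x - m)) U.Ω :=
    U.integrableOn_of_continuousAt fun x hx => (hρc x hx).mul (hwc x hx)
  have iρd : IntegrableOn (fun x => ρ t x * |M.dcψ₀ (ρ t x) (c t x)|) U.Ω :=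
    U.integrableOn_of_continuousAt fun x hx => (hρc x hx).mul (hdc x hx).abs
  have iρ2 : IntegrableOn (fun x => ρ t x ^ 2) U.Ω :=
    U.integrableOn_of_continuousAt fun x hx => (hρc x hx).pow 2
  have iw2 : IntegrableOn (fun x => (μ t x - m) ^ 2) U.Ω :=
    U.integrableOn_of_continuousAt fun x hx => (hwc x hx).pow 2
  have iρμ : IntegrableOn (fun x => ρ t x * μ t x) U.Ω :=
    U.integrableOn_of_continuousAt fun x hx =>
      (hρc x hx).mul (hs.contUpToBoundary_μ.slice htI hx)
  have iD := (contUpToBoundary_dissipationDensity hM hs).integrableOn htI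
  have iμ : IntegrableOn (fun x => ‖∇ (μ t) x‖ ^ 2) U.Ω :=
    U.integrableOn_of_continuousAt fun x hx => (contDiffAt_gradient
      (SmoothAt.slice (hs.reg_μ t htI x hx))).continuousAt.norm.pow 2
  have iE : IntegrableOn (fun x => A + B * energyDensity M (ρ t) (v t) (c t) x) U.Ω :=
    (U.integrableOn_const A).add
      (((hs.contUpToBoundary_energyDensity hM).integrableOn htI).const_mul B)
  -- the fluctuating part of the potential
  have h1 : ∫ x in U.Ω, (μ t x - m) * M.F (ρ t x) (c t x) ≤
      K * ∫ x in U.Ω, ρ t x * |μ t x - m| := by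
    rw [← integral_const_mul]
    refine setIntegral_le_of_le U iwF (iρw.const_mul K) fun x hx => ?_
    calc _ ≤ |μ t x - m| * |M.F (ρ t x) (c t x)| := by rw [← abs_mul]; exact le_abs_self _
      _ ≤ |μ t x - m| * (K * ρ t x) := by gcongr; exact hK _ _ (hρpos x hx)
      _ = _ := by ring
  -- the constant part of the potential
  have h2 : m * ∫ x in U.Ω, M.F (ρ t x) (c t x) ≤
      K * ((∫ x in U.Ω, ρ t x * |M.dcψ₀ (ρ t x) (c t x)|) + ∫ x in U.Ω, ρ t x * |μ t x - m|) := by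
    have hF : |∫ x in U.Ω, M.F (ρ t x) (c t x)| ≤ K * ∫ x in U.Ω, ρ t x := by
      rw [← integral_const_mul]
      refine (abs_integral_le_integral_abs).trans ?_
      exact setIntegral_le_of_le U iF.abs (iρ.const_mul K) fun x hx => hK _ _ (hρpos x hx)
    have hρ0 : 0 ≤ ∫ x in U.Ω, ρ t x :=
      setIntegral_nonneg U.isOpen.measurableSet fun x hx => (hρpos x hx).le
    -- There is no bound on `m` alone; its product with the total mass is what `|F| ≤ K ρ` requires
    -- and what the integrated potential equation provides.
    have e : (∫ x in U.Ω, ρ t x) * m =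
        (∫ x in U.Ω, ρ t x * M.dcψ₀ (ρ t x) (c t x)) - ∫ x in U.Ω, ρ t x * (μ t x - m) := by
      rw [← integral_density_mul_potential hM hs ht, ← integral_sub iρμ iρw', ← integral_mul_const]
      congr 1
      ext x
      ring
    have e1 : |∫ x in U.Ω, ρ t x * M.dcψ₀ (ρ t x) (c t x)| ≤
        ∫ x in U.Ω, ρ t x * |M.dcψ₀ (ρ t x) (c t x)| := by
      refine (abs_integral_le_integral_abs).trans (le_of_eq ?_)
      refine setIntegral_congr_fun U.isOpen.measurableSet fun x hx => ?_
      simp only [abs_mul, abs_of_pos (hρpos x hx)]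
    have e2 : |∫ x in U.Ω, ρ t x * (μ t x - m)| ≤ ∫ x in U.Ω, ρ t x * |μ t x - m| := by
      refine (abs_integral_le_integral_abs).trans (le_of_eq ?_)
      refine setIntegral_congr_fun U.isOpen.measurableSet fun x hx => ?_
      simp only [abs_mul, abs_of_pos (hρpos x hx)]
    calc _ ≤ |m| * |∫ x in U.Ω, M.F (ρ t x) (c t x)| := by rw [← abs_mul]; exact le_abs_self _
      _ ≤ |m| * (K * ∫ x in U.Ω, ρ t x) := by gcongr
      _ = K * |(∫ x in U.Ω, ρ t x) * m| := by rw [abs_mul, abs_of_nonneg hρ0]; ring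
      _ ≤ _ := by
        rw [e]
        gcongr
        exact (abs_sub _ _).trans (add_le_add e1 e2)
  have hsplit : ∫ x in U.Ω, μ t x * M.F (ρ t x) (c t x) =
      (∫ x in U.Ω, (μ t x - m) * M.F (ρ t x) (c t x)) +
        m * ∫ x in U.Ω, M.F (ρ t x) (c t x) := by
    rw [← integral_const_mul, ← integral_add iwF (iF.const_mul m)]
    congr 1
    ext x
    ring
  -- The factor `2` is there because the fluctuation term appears in both `h1` and `h2`.
  have hyoung : 2 * K * ∫ x in U.Ω, ρ t x * |μ t x - m| ≤
      δ * (∫ x in U.Ω, (μ t x - m) ^ 2) + K ^ 2 / δ * ∫ x in U.Ω, ρ t x ^ 2 := by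
    rw [← integral_const_mul, ← integral_const_mul, ← integral_const_mul,
      ← integral_add (iw2.const_mul _) (iρ2.const_mul _)]
    refine setIntegral_le_of_le U (iρw.const_mul _) ((iw2.const_mul _).add (iρ2.const_mul _))
      fun x hx => ?_
    have : 0 ≤ δ * (|μ t x - m| - K / δ * ρ t x) ^ 2 := by positivity
    have e : δ * (|μ t x - m| - K / δ * ρ t x) ^ 2 =
        δ * (μ t x - m) ^ 2 + K ^ 2 / δ * ρ t x ^ 2 - 2 * K * (ρ t x * |μ t x - m|) := by
      rw [← sq_abs (μ t x - m)]
      field_simp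
      ring
    linarith
  have hD : δ * (∫ x in U.Ω, (μ t x - m) ^ 2) ≤ dissipation M U ρ v c μ t / 2 := by
    have h3 : b₀ * ∫ x in U.Ω, ‖∇ (μ t) x‖ ^ 2 ≤ dissipation M U ρ v c μ t := by
      rw [← integral_const_mul]
      exact setIntegral_le_of_le U (iμ.const_mul _) iD fun x hx =>
        dissipationDensity_ge h hb (v t) (c t) (μ t) (hρpos x hx)
    calc _ ≤ δ * (C * ∫ x in U.Ω, ‖∇ (μ t) x‖ ^ 2) := by gcongr
      _ = (b₀ * ∫ x in U.Ω, ‖∇ (μ t) x‖ ^ 2) / 2 := by rw [hδ]; field_simp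
      _ ≤ _ := by linarith
  have hfin : K ^ 2 / δ * (∫ x in U.Ω, ρ t x ^ 2) +
      K * (∫ x in U.Ω, ρ t x * |M.dcψ₀ (ρ t x) (c t x)|) ≤
      (K ^ 2 / δ + K) * ∫ x in U.Ω, (A + B * energyDensity M (ρ t) (v t) (c t) x) := by
    have h4 : ∀ x ∈ U.Ω, ρ t x ^ 2 + ρ t x * |M.dcψ₀ (ρ t x) (c t x)| ≤
        A + B * energyDensity M (ρ t) (v t) (c t) x := fun x hx => by
      refine (hAB _ _ (hρpos x hx)).trans ?_
      gcongr
      exact le_energyDensity h (v t) (c t) (hρpos x hx)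
    rw [add_mul]
    refine add_le_add (mul_le_mul_of_nonneg_left ?_ (by positivity))
      (mul_le_mul_of_nonneg_left ?_ hK0)
    · refine setIntegral_le_of_le U iρ2 iE fun x hx => le_trans ?_ (h4 x hx)
      have := mul_nonneg (hρpos x hx).le (abs_nonneg (M.dcψ₀ (ρ t x) (c t x)))
      linarith
    · refine setIntegral_le_of_le U iρd iE fun x hx => le_trans ?_ (h4 x hx)
      linarith [sq_nonneg (ρ t x)]
  rw [hsplit]
  linarith

end Estimate

/-! ### Gronwall argument and the a priori bound -/

section Bound

open Filter Topology

variable {M : Model} {U : RegularDomain} {T : ℝ} {ρ : ℝ → E3 → ℝ} {v : ℝ → E3 → E3}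
  {c μ : ℝ → E3 → ℝ}

theorem continuousOn_energy (hM : M.Regular) (hs : IsSolution M U T ρ v c μ) :
    ContinuousOn (energy M U ρ v c) (Icc 0 T) :=
  (hs.contUpToBoundary_energyDensity hM).continuousOn_integral

theorem continuousOn_dissipation (hM : M.Regular) (hs : IsSolution M U T ρ v c μ) :
    ContinuousOn (dissipation M U ρ v c μ) (Icc 0 T) :=
  (contUpToBoundary_dissipationDensity hM hs).continuousOn_integral

/-- Gronwall's inequality for a function which satisfies a differential inequality with an
additional dissipation. -/
theorem add_integral_le_of_deriv_le {Y Y' D : ℝ → ℝ} {L : ℝ} (hT : 0 ≤ T) (hL : 0 ≤ L)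
    (hY : ContinuousOn Y (Icc 0 T)) (hD : ContinuousOn D (Icc 0 T))
    (hD0 : ∀ t ∈ Icc 0 T, 0 ≤ D t) (hY0 : 0 ≤ Y 0)
    (hd : ∀ t ∈ Ioo 0 T, HasDerivAt Y (Y' t) t) (hle : ∀ t ∈ Ioo 0 T, Y' t + D t ≤ L * Y t)
    {t : ℝ} (ht : t ∈ Icc 0 T) :
    Y t + ∫ s in (0 : ℝ)..t, D s ≤ Real.exp (L * T) * Y 0 := by
  have hint : IntervalIntegrable D volume 0 T :=
    ContinuousOn.intervalIntegrable (by rwa [uIcc_of_le hT])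
  set P : ℝ → ℝ := fun t => Y t + ∫ s in (0 : ℝ)..t, D s with hP
  have hPc : ContinuousOn P (Icc 0 T) := by
    refine hY.add ?_
    have := intervalIntegral.continuousOn_primitive_interval (μ := volume) (f := D) (a := 0) (b := T)
      (by rw [uIcc_of_le hT]; exact hD.integrableOn_Icc)
    rwa [uIcc_of_le hT] at this
  have hPd : ∀ t ∈ Ioo 0 T, HasDerivAt P (Y' t + D t) t := fun t ht => by
    refine (hd t ht).add (intervalIntegral.integral_hasDerivAt_right ?_ ?_ ?_)
    · exact hint.mono_set (by
        rw [uIcc_of_le hT, uIcc_of_le ht.1.le]; exact Icc_subset_Icc_right ht.2.le)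
    · exact (hD.mono Ioo_subset_Icc_self).stronglyMeasurableAtFilter isOpen_Ioo t ht
    · exact hD.continuousAt (Icc_mem_nhds ht.1 ht.2)
  -- The integrating factor is applied to `P`, which includes the accumulated dissipation; as that
  -- is nonnegative, `L * Y ≤ L * P`.
  have hanti : AntitoneOn (fun t => P t * Real.exp (-L * t)) (Icc 0 T) := by
    have hder : ∀ t ∈ Ioo 0 T, HasDerivAt (fun t => P t * Real.exp (-L * t))
        ((Y' t + D t) * Real.exp (-L * t) + P t * (Real.exp (-L * t) * (-L))) t := fun t ht => by
      refine (hPd t ht).mul ?_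
      have := ((hasDerivAt_id t).const_mul (-L)).exp
      simpa using this
    refine antitoneOn_of_deriv_nonpos (convex_Icc 0 T)
      (hPc.mul (by fun_prop)) ?_ ?_
    · rw [interior_Icc]
      exact fun t ht => (hder t ht).differentiableAt.differentiableWithinAt
    · rw [interior_Icc]
      intro t ht
      rw [(hder t ht).deriv]
      have h0 : 0 ≤ ∫ s in (0 : ℝ)..t, D s := intervalIntegral.integral_nonneg ht.1.le
        fun s hs => hD0 s ⟨hs.1, hs.2.trans ht.2.le⟩
      have h1 : Y' t + D t ≤ L * P t := (hle t ht).trans (by gcongr; simp only [hP]; linarith)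
      have h2 := Real.exp_pos (-L * t)
      nlinarith
  have h1 := hanti ⟨le_rfl, hT⟩ ht ht.1
  have hP0 : P 0 = Y 0 := by simp [hP]
  simp only [hP0, mul_zero, Real.exp_zero, mul_one] at h1
  have h2 : P t = P t * Real.exp (-L * t) * Real.exp (L * t) := by
    rw [mul_assoc, ← Real.exp_add]
    simp
  calc P t = P t * Real.exp (-L * t) * Real.exp (L * t) := h2
    _ ≤ Y 0 * Real.exp (L * t) := by gcongr
    _ ≤ Y 0 * Real.exp (L * T) := by gcongr; exact ht.2
    _ = _ := mul_comm _ _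

theorem integral_const_add_mul_energyDensity (hM : M.Regular) (hs : IsSolution M U T ρ v c μ)
    (A B : ℝ) {t : ℝ} (ht : t ∈ Icc 0 T) :
    ∫ x in U.Ω, (A + B * energyDensity M (ρ t) (v t) (c t) x) =
      A * volume.real U.Ω + B * energy M U ρ v c t := by
  rw [integral_add (U.integrableOn_const A)
    (((hs.contUpToBoundary_energyDensity hM).integrableOn ht).const_mul B), integral_const_mul,
    energy]
  simp [mul_comm]

theorem exists_energy_bound (hM : M.Regular) {a : ℝ} (h : M.Admissible a) (U : RegularDomain)
    (hT : 0 < T) : ∃ C₁ C₂ : ℝ, 0 < C₁ ∧ 0 < C₂ ∧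
      ∀ (ρ : ℝ → E3 → ℝ) (v : ℝ → E3 → E3) (c μ : ℝ → E3 → ℝ), IsSolution M U T ρ v c μ →
        ∀ t ∈ Icc 0 T, energy M U ρ v c t + ∫ s in (0 : ℝ)..t, dissipation M U ρ v c μ s ≤
          C₁ + C₂ * energy M U ρ v c 0 := by
  obtain ⟨A, B, hA, hB, hAB⟩ := h.exists_sq_add_le hM
  obtain ⟨L, hL, hsrc⟩ := integral_mul_source_le hM h U hB hAB
  set V := volume.real U.Ω with hV
  have hV0 : 0 ≤ V := measureReal_nonneg
  set X := Real.exp (B * L * T) with hX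
  have hX0 : 0 < X := Real.exp_pos _
  -- Gronwall leaves the coefficient `B / 2` on the dissipation integral. Doubling restores `B`, and
  -- the surplus `A * V` and `A * V + B * E t` are nonnegative and dropped. The `+ 1` secures strict
  -- positivity.
  refine ⟨2 * X * A * V / B + 1, 2 * X, by positivity, by positivity, fun ρ v c μ hs t ht => ?_⟩
  set E := energy M U ρ v c with hE
  set D := dissipation M U ρ v c μ with hD
  have hY0 : ∀ t ∈ Icc 0 T, 0 ≤ A * V + B * E t := fun t ht => by
    rw [hV, hE, ← integral_const_add_mul_energyDensity hM hs A B ht]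
    refine setIntegral_nonneg U.isOpen.measurableSet fun x hx => ?_
    have hρ := hs.ρ_pos t ht x (subset_closure hx)
    have h1 := hAB (ρ t x) (c t x) hρ
    have h2 := mul_le_mul_of_nonneg_left (le_energyDensity h (v t) (c t) hρ) hB.le
    have h3 : 0 ≤ ρ t x ^ 2 + ρ t x * |M.dcψ₀ (ρ t x) (c t x)| := by positivity
    linarith
  have hDc : ContinuousOn D (Icc 0 T) := continuousOn_dissipation hM hs
  have hEc : ContinuousOn E (Icc 0 T) := continuousOn_energy hM hs
  have hD0 : ∀ t ∈ Icc 0 T, 0 ≤ D t := fun t ht => dissipation_nonneg h hs ht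
  -- The energy itself need not be nonnegative, whereas `A * V + B * E` is the integral of a
  -- nonnegative density and obeys a linear differential inequality.
  have key := add_integral_le_of_deriv_le (Y := fun t => A * V + B * E t)
    (Y' := fun t => B * ((∫ x in U.Ω, μ t x * M.F (ρ t x) (c t x)) - D t))
    (D := fun t => B / 2 * D t) (L := B * L) hT.le (by positivity)
    (continuousOn_const.add (continuousOn_const.mul hEc)) (continuousOn_const.mul hDc)
    (fun t ht => mul_nonneg (by positivity) (hD0 t ht)) (hY0 0 ⟨le_rfl, hT.le⟩)
    (fun t ht => ((hasDerivAt_energy hM hs ht).const_mul B).const_add _)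
    (fun t ht => by
      have h1 := hsrc T ρ v c μ hs t ht
      rw [integral_const_add_mul_energyDensity hM hs A B (Ioo_subset_Icc_self ht)] at h1
      have h2 := mul_le_mul_of_nonneg_left h1 hB.le
      linarith) ht
  rw [intervalIntegral.integral_const_mul] at key
  have hYt := hY0 t ht
  have hAV : 0 ≤ A * V := by positivity
  simp only [← hX] at key
  refine le_of_mul_le_mul_left ?_ hB
  have e : B * (2 * X * A * V / B + 1 + 2 * X * E 0) = 2 * (X * (A * V + B * E 0)) + B := by
    field_simp
    ring
  rw [e]
  linarith

end Bound

end GNSCH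

/-! ### The energy law and the a priori bound together -/

theorem proposition3p1 (U : GNSCH.RegularDomain) (T : ℝ) (hT : 0 < T)
    (M : GNSCH.Model) (hM : M.Regular) :
    (∀ (ρ : ℝ → GNSCH.E3 → ℝ) (v : ℝ → GNSCH.E3 → GNSCH.E3) (c μ : ℝ → GNSCH.E3 → ℝ),
      GNSCH.IsSolution M U T ρ v c μ →
      ∀ t ∈ Ioo 0 T,
        IntegrableOn (GNSCH.energyDensity M (ρ t) (v t) (c t)) U.Ω ∧
        IntegrableOn (GNSCH.dissipationDensity M (ρ t) (v t) (c t) (μ t)) U.Ω ∧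
        IntegrableOn (fun x => μ t x * M.F (ρ t x) (c t x)) U.Ω ∧
        DifferentiableAt ℝ (GNSCH.energy M U ρ v c) t ∧
        deriv (GNSCH.energy M U ρ v c) t + GNSCH.dissipation M U ρ v c μ t =
          ∫ x in U.Ω, μ t x * M.F (ρ t x) (c t x)) ∧
    (∀ a : ℝ, M.Admissible a →
      ∃ C₁ C₂ : ℝ, 0 < C₁ ∧ 0 < C₂ ∧
        ∀ (ρ : ℝ → GNSCH.E3 → ℝ) (v : ℝ → GNSCH.E3 → GNSCH.E3) (c μ : ℝ → GNSCH.E3 → ℝ),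
          GNSCH.IsSolution M U T ρ v c μ →
          ∀ t ∈ Icc 0 T,
            IntervalIntegrable (GNSCH.dissipation M U ρ v c μ) volume 0 t ∧
            GNSCH.energy M U ρ v c t + ∫ s in (0 : ℝ)..t, GNSCH.dissipation M U ρ v c μ s ≤
              C₁ + C₂ * GNSCH.energy M U ρ v c 0) := by
  refine ⟨fun ρ v c μ hs t ht => ?_, fun a ha => ?_⟩
  · have htI := Ioo_subset_Icc_self ht
    have hd := GNSCH.hasDerivAt_energy hM hs ht
    refine ⟨(hs.contUpToBoundary_energyDensity hM).integrableOn htI,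
      (GNSCH.contUpToBoundary_dissipationDensity hM hs).integrableOn htI,
      GNSCH.integrableOn_mul_source hM hs ht, hd.differentiableAt, ?_⟩
    rw [hd.deriv, sub_add_cancel]
  · obtain ⟨C₁, C₂, h₁, h₂, hC⟩ := GNSCH.exists_energy_bound hM ha U hT
    refine ⟨C₁, C₂, h₁, h₂, fun ρ v c μ hs t ht => ⟨?_, hC ρ v c μ hs t ht⟩⟩
    refine ((GNSCH.continuousOn_dissipation hM hs).mono ?_).intervalIntegrable
    rw [uIcc_of_le ht.1]
    exact Icc_subset_Icc_right ht.2
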